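/- Notation. For a finite simple graph $G$ on a vertex set $V$ with $|V|=n$, $e_G(X,Y)$ is the number of edges between disjoint sets $X,Y\subseteq V$ and $e_G(X)$ is the number of edges inside $X$. For $\eta,\alpha>0$, a graph $G$ on $n$ vertices is $(\eta,\alpha)$-robust if $\delta(G)\ge \eta n$ and $e_G(X,V\setminus X)\ge\alpha|X||V\setminus X|$ for every $X\subseteq V$. For $\beta>0$, $G$ is $\beta$-near-bipartite if there is $X\subseteq V$ with $e_G(X)<\beta n^2$ and $e_G(V\setminus X)<\beta n^2$. If $V=X\sqcup Y$, then $G[X,Y]$ is the spanning bipartite subgraph of $G$ consisting of all edges of $G$ between $X$ and $Y$. Absorbing Lemma. There are functions $\alpha_0:(0,\infty)\to(0,\infty)$ and $n_0:(0,\infty)\to\mathbb N$ such that the following holds for all $\eta>0$ and $0<\alpha\le\alpha_0(\eta)$. Let $\rho:=\alpha^{32/\alpha^2}$ and let $G$ be an $(\eta,\alpha)$-robust graph on $n\ge n_0(\alpha)$ vertices. (i) If $G$ is not $\alpha^4$-near-bipartite, then $G$ contains a path $P^*$ on at most $\rho n$ vertices such that for every $W\subseteq V(G)\setminus V(P^*)$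 with $|W|\le\rho^3n$, the graph $G[V(P^*)\cup W]$ contains a spanning path with the same endpoints as $P^*$. (ii) If $G$ is $\alpha^4$-near-bipartite, then there is a partition $V(G)=X\sqcup Y$ such that $H:=G[X,Y]$ is $(\eta/2,\alpha/2)$-robust and $H$ contains a path $P^*$ on at most $\rho n$ vertices such that for every $W\subseteq V(G)\setminus V(P^*)$ with $|W\cap X|=|W\cap Y|\le\rho^3n$, the graph $H[V(P^*)\cup W]$ (and hence also $G[V(P^*)\cup W]$) contains a spanning path with the same endpoints as $P^*$. -/

import Mathlib

namespace RobustAbsorb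

variable {V : Type*} [Fintype V]

open Classical in
/-- `e_G(X, Y)` for disjoint `X`, `Y`: the number of edges of `G` between `X` and `Y`. -/
noncomputable def edgesBetween (G : SimpleGraph V) (X Y : Finset V) : ℕ :=
  (G.interedges X Y).card

open Classical in
/-- `e_G(X)`: the number of edges of `G` with both ends in `X`. -/
noncomputable def edgesInside (G : SimpleGraph V) (X : Finset V) : ℕ :=
  (G.edgeFinset.filter (fun e => ∀ v ∈ e, v ∈ X)).card

open Classical in
/-- `G` has an `α`-sparse cut: `e(X, V ∖ X) < α |X| |V ∖ X|` for some vertex set `X`. -/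
def HasSparseCut (G : SimpleGraph V) (α : ℝ) : Prop :=
  ∃ X : Finset V, (edgesBetween G X Xᶜ : ℝ) < α * X.card * (Xᶜ).card

open Classical in
/-- A graph on the `n`-element vertex set `V` is `(η, α)`-robust: its minimum degree is at least
`η n` and it has no `α`-sparse cut. -/
def IsRobust (G : SimpleGraph V) (η α : ℝ) : Prop :=
  η * Fintype.card V ≤ G.minDegree ∧ ¬ HasSparseCut G α

open Classical in
/-- `G` is `β`-near-bipartite: `e(X) < β n²` and `e(V ∖ X) < β n²` for some vertex set `X`. -/
def IsNearBipartite (G : SimpleGraph V) (β : ℝ) : Prop :=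
  ∃ X : Finset V, (edgesInside G X : ℝ) < β * (Fintype.card V : ℝ) ^ 2 ∧
    (edgesInside G Xᶜ : ℝ) < β * (Fintype.card V : ℝ) ^ 2

/-- The path `p` absorbs the vertex set `W` in `G`: the subgraph of `G` induced on `V(p) ∪ W`
has a spanning path with the same end vertices as `p`. -/
def Absorbs (G : SimpleGraph V) {u v : V} (p : G.Walk u v) (W : Finset V) : Prop :=
  ∃ q : G.Walk u v, q.IsPath ∧ ∀ z : V, z ∈ q.support ↔ z ∈ p.support ∨ z ∈ W

end RobustAbsorb

/-! The path `P*` is built from small gadgets, each a system of disjoint short paths that can be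
rerouted, with the same ends, to swallow two extra vertices `w`, `w'`. A gadget contains two paths
`x r y` and `x' r' y'` with `w` adjacent to `x`, `y` and `w'` adjacent to `x'`, `y'`. Putting `w`
for `r` and `w'` for `r'` leaves `r`, `r'` homeless. A chain of vertices `r = v₀, v₁, ..., v_k = z`
with large consecutive codegrees gives triples `c v_{i+1} d`, each replaceable by `c v_i d`, so `r`
is taken in and `z` is released. Finally an edge `ab` with `a r' z b` a path takes in `r'` and `z`
(`exists_shift`, `exists_pair_absorber`).

The required chains exist because the codegree graph is robustly connected. If a small set separated
it into `A` and `B`, then Σ d_A(v) d_B(v) would be small, so almost every vertex would see almost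
only one side. As `G` has no sparse cut, the vertices of `A` must almost all look towards `B` and
conversely, so `A` and `B` are both sparse (`pairs_separated_upper`). This contradicts not being
near-bipartite. In the near-bipartite case one passes to a maximum cut `H`, which stays robust
(`exists_robust_cut`), and the same argument links vertices within one side. There `w` and `w'` are
taken from opposite sides, so that `r` and `z` lie on the same side.

A positive proportion of pairs of cherries fits any given pair `(w, w')`. A derandomised greedy
choice with potential Σ 2^{-hits} therefore gives few disjoint gadgets such that each admissible
pair is absorbed by many of them (`exists_absorbing_family`). Short connections, again from
robustness, join all gadgets into one path (`exists_link`). A leftover set is split into pairs and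
each pair gets its own gadget. When `|W|` is odd in the non-bipartite case, one extra piece, a path
with an odd number of vertices between adjacent `x` and `y`, is replaced by the edge `xy`; its odd
number of released inner vertices repairs the parity. -/

namespace RobustAbsorb

/-! ### Path systems, rerouting, and joining a system into one path -/

section PathSystems

variable {V : Type*}

/-- `l'` is a path-like list with the same first and last entries as `l`. -/
def SameEnds (G : SimpleGraph V) (l l' : List V) : Prop :=
  l'.head? = l.head? ∧ l'.getLast? = l.getLast? ∧ l'.IsChain G.Adj

/-- Every list of the system `C` can be replaced by a chain with the same ends so that
the new lists together use exactly the multiset `M` of vertices. -/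
def Reroutes (G : SimpleGraph V) (C : List (List V)) (M : Multiset V) : Prop :=
  ∃ C' : List (List V), List.Forall₂ (SameEnds G) C C' ∧ (C'.flatten : Multiset V) = M

/-- A system of pairwise disjoint nonempty paths that avoids `U`. -/
structure IsPathSystem (G : SimpleGraph V) (U : Finset V) (C : List (List V)) : Prop where
  ne_nil : ∀ l ∈ C, l ≠ []
  chain : ∀ l ∈ C, l.IsChain G.Adj
  nodup : C.flatten.Nodup
  avoid : ∀ v ∈ C.flatten, v ∉ U

variable {G : SimpleGraph V}

theorem Reroutes.self {C : List (List V)} (h : ∀ l ∈ C, l.IsChain G.Adj) :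
    Reroutes G C (C.flatten : Multiset V) :=
  ⟨C, List.forall₂_same.2 fun l hl => ⟨rfl, rfl, h l hl⟩, rfl⟩

theorem Reroutes.append {C D : List (List V)} {M N : Multiset V} (hC : Reroutes G C M)
    (hD : Reroutes G D N) : Reroutes G (C ++ D) (M + N) := by
  obtain ⟨C', hC', rfl⟩ := hC
  obtain ⟨D', hD', rfl⟩ := hD
  exact ⟨C' ++ D', List.rel_append hC' hD', by simp⟩

/-- Only the multiset of used vertices is recorded, so the place where a gadget sits in the list is
irrelevant. This allows a gadget to be set aside and put back during an induction. -/
theorem Reroutes.insert {A B C : List (List V)} {M N : Multiset V}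
    (h : Reroutes G (A ++ B) M) (hC : Reroutes G C N) : Reroutes G (A ++ C ++ B) (M + N) := by
  obtain ⟨E, hE, rfl⟩ := h
  obtain ⟨C', hC', rfl⟩ := hC
  have hE1 := List.forall₂_take A.length hE
  have hE2 := List.forall₂_drop A.length hE
  simp only [List.take_left', List.drop_left'] at hE1 hE2
  refine ⟨E.take A.length ++ C' ++ E.drop A.length,
    List.rel_append (List.rel_append hE1 hC') hE2, ?_⟩
  have : E.flatten = (E.take A.length).flatten ++ (E.drop A.length).flatten := by
    rw [← List.flatten_append, List.take_append_drop]
  rw [this]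
  simp only [List.flatten_append, ← Multiset.coe_add]
  abel

theorem Reroutes.cons {l l' : List V} {C : List (List V)} {M : Multiset V}
    (hl : SameEnds G l l') (hC : Reroutes G C M) : Reroutes G (l :: C) (l' + M) := by
  obtain ⟨C', hC', rfl⟩ := hC
  exact ⟨l' :: C', List.Forall₂.cons hl hC', by simp⟩

theorem Reroutes.nil : Reroutes G [] (0 : Multiset V) := ⟨[], List.Forall₂.nil, by simp⟩

theorem Reroutes.cons_iff {l : List V} {C : List (List V)} {M : Multiset V} :
    Reroutes G (l :: C) M ↔ ∃ l' N, SameEnds G l l' ∧ Reroutes G C N ∧ M = l' + N := by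
  constructor
  · rintro ⟨E, hE, rfl⟩
    obtain ⟨l', C', hl, hC, rfl⟩ := List.forall₂_cons_left_iff.1 hE
    exact ⟨l', _, hl, ⟨C', hC, rfl⟩, by simp⟩
  · rintro ⟨l', N, hl, hC, rfl⟩
    exact hC.cons hl

/-- The junction between consecutive pieces depends only on their end entries, which rerouting
preserves; hence rerouting the pieces of one long path gives again a path-like list with the same
ends. -/
theorem sameEnds_flatten {C C' : List (List V)} (h : List.Forall₂ (SameEnds G) C C')
    (hC : C.flatten.IsChain G.Adj) : SameEnds G C.flatten C'.flatten := by
  induction h with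
  | nil => exact ⟨rfl, rfl, hC⟩
  | @cons l l' C C' hl _ ih =>
    rw [List.flatten_cons, List.isChain_append] at hC
    obtain ⟨ih1, ih2, ih3⟩ := ih hC.2.1
    obtain ⟨h1, h2, h3⟩ := hl
    refine ⟨?_, ?_, ?_⟩
    · simp only [List.flatten_cons, List.head?_append, h1, ih1]
    · simp only [List.flatten_cons, List.getLast?_append, h2, ih2]
    · rw [List.flatten_cons, List.isChain_append, h2, ih1]
      exact ⟨h3, ih3, hC.2.2⟩

theorem IsPathSystem.append {U : Finset V} {C D : List (List V)} (hC : IsPathSystem G U C)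
    (hD : IsPathSystem G U D) (h : ∀ v ∈ C.flatten, v ∉ D.flatten) :
    IsPathSystem G U (C ++ D) where
  ne_nil l hl := (List.mem_append.1 hl).elim (hC.ne_nil l) (hD.ne_nil l)
  chain l hl := (List.mem_append.1 hl).elim (hC.chain l) (hD.chain l)
  nodup := by
    rw [List.flatten_append, List.nodup_append']
    exact ⟨hC.nodup, hD.nodup, fun v h1 h2 => h v h1 h2⟩
  avoid v hv := by
    rw [List.flatten_append] at hv
    exact (List.mem_append.1 hv).elim (hC.avoid v) (hD.avoid v)

theorem IsPathSystem.mono {U U' : Finset V} {C : List (List V)} (hC : IsPathSystem G U C)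
    (h : U' ⊆ U) : IsPathSystem G U' C :=
  ⟨hC.ne_nil, hC.chain, hC.nodup, fun v hv hv' => hC.avoid v hv (h hv')⟩

/-- Between any two vertices outside a set of size at most `D` there is a path of length at most `K`
avoiding this set. -/
def ShortlyLinked (G : SimpleGraph V) (D K : ℕ) : Prop :=
  ∀ (U : Finset V) (a b : V), U.card ≤ D → a ∉ U → b ∉ U →
    ∃ p : G.Walk a b, p.IsPath ∧ p.length ≤ K ∧ ∀ v ∈ p.support, v ∉ U

theorem exists_interior_of_walk {a b : V} (hab : a ≠ b) (p : G.Walk a b) :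
    ∃ I : List V, p.support = a :: (I ++ [b]) ∧ I.length + 1 = p.length := by
  cases p with
  | nil => exact absurd rfl hab
  | @cons _ c _ h q =>
    refine ⟨q.support.dropLast, ?_, ?_⟩
    · rw [SimpleGraph.Walk.support_cons]
      congr 1
      conv_lhs => rw [← List.dropLast_append_getLast q.support_ne_nil]
      rw [SimpleGraph.Walk.getLast_support]
    · simp

-- Each path is extended by the interior of a short connection to the next one, and `E` collects
-- these interiors. Since the connector is appended after the last vertex, any rerouting of the path
-- carries over with the connector unchanged. A path has at least one vertex and a connector at most
-- `K`, whence the factor `K + 1`.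
open Classical in
theorem exists_link {D K : ℕ} (hG : ShortlyLinked G D K) :
    ∀ (C : List (List V)) (U : Finset V), C ≠ [] → IsPathSystem G U C →
      U.card + (K + 1) * C.flatten.length ≤ D →
      ∃ (C' : List (List V)) (E : Multiset V), C'.flatten.IsChain G.Adj ∧ C'.flatten.Nodup ∧
        C'.flatten ≠ [] ∧ (∀ v ∈ C'.flatten, v ∉ U) ∧
        C'.flatten.length ≤ (K + 1) * C.flatten.length ∧
        (C'.flatten : Multiset V) = C.flatten + E ∧
        ∀ M, Reroutes G C M → Reroutes G C' (M + E) := by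
  intro C
  induction C with
  | nil => intro U h; exact absurd rfl h
  | cons S R ih =>
    intro U _ hC hcard
    have hS : S ≠ [] := hC.ne_nil S (by simp)
    have hSl : 1 ≤ S.length := List.length_pos_iff.2 hS
    have hnd := hC.nodup
    rw [List.flatten_cons, List.nodup_append'] at hnd
    by_cases hR : R = []
    · subst hR
      refine ⟨[S], 0, ?_, hC.nodup, ?_, hC.avoid, ?_, by simp, fun M h => by simpa using h⟩
      · simpa using hC.chain S (by simp)
      · simpa using hS
      · exact Nat.le_mul_of_pos_left _ (by omega)
    have hlen : (S :: R).flatten.length = S.length + R.flatten.length := by simp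
    rw [hlen, mul_add] at hcard
    have hK1 : S.length ≤ (K + 1) * S.length := Nat.le_mul_of_pos_left _ (by omega)
    have hcU : (U ∪ S.toFinset).card ≤ U.card + S.length :=
      (Finset.card_union_le _ _).trans (by have := S.toFinset_card_le; omega)
    obtain ⟨R', E, h1, h2, h3, h4, h5, h6, h7⟩ := ih (U ∪ S.toFinset) hR
      ⟨fun l hl => hC.ne_nil l (by simp [hl]), fun l hl => hC.chain l (by simp [hl]), hnd.2.1,
        fun v hv => by
          simp only [Finset.mem_union, List.mem_toFinset, not_or]
          exact ⟨hC.avoid v (by simpa using Or.inr (by simpa using hv)),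
            fun h => hnd.2.2 h hv⟩⟩ (by omega)
    simp only [Finset.mem_union, List.mem_toFinset, not_or] at h4
    obtain ⟨S0, a, rfl⟩ : ∃ S0 a, S = S0 ++ [a] :=
      ⟨S.dropLast, S.getLast hS, (List.dropLast_append_getLast hS).symm⟩
    obtain ⟨b, F, hF⟩ := List.exists_cons_of_ne_nil h3
    have hSU : ∀ v ∈ S0 ++ [a], v ∉ U := fun v hv => hC.avoid v (by
      rw [List.flatten_cons]; exact List.mem_append_left _ hv)
    have hSn : (S0 ++ [a]).Nodup := hnd.1
    have hFn : (b :: F).Nodup := hF ▸ h2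
    have hFS : ∀ v ∈ b :: F, v ∉ S0 ++ [a] := fun v hv => (h4 v (hF ▸ hv)).2
    have hFU : ∀ v ∈ b :: F, v ∉ U := fun v hv => (h4 v (hF ▸ hv)).1
    have hab : a ≠ b := fun h => hFS b (by simp) (by simp [h])
    have hSc := hC.chain (S0 ++ [a]) (by simp)
    have hFc : (b :: F).IsChain G.Adj := hF ▸ h1
    have hFl : (b :: F).length ≤ (K + 1) * R.flatten.length := hF ▸ h5
    have hcU' : (U ∪ S0.toFinset ∪ F.toFinset).card ≤ U.card + S0.length + F.length := by
      have e1 := Finset.card_union_le (U ∪ S0.toFinset) F.toFinset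
      have e2 := Finset.card_union_le U S0.toFinset
      have e3 := S0.toFinset_card_le
      have e4 := F.toFinset_card_le
      omega
    simp only [List.length_append, List.length_cons, List.length_nil] at hK1 hSl hFl hcard
    rw [List.nodup_append'] at hSn
    -- Everything used so far is forbidden except the two vertices `a`, `b` to be joined.
    obtain ⟨p, hp, hpl, hpU⟩ := hG (U ∪ S0.toFinset ∪ F.toFinset) a b (by omega)
      (by
        simp only [Finset.mem_union, List.mem_toFinset, not_or]
        exact ⟨⟨hSU a (by simp), fun h => hSn.2.2 h (by simp)⟩,
          fun h => hFS a (by simp [h]) (by simp)⟩)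
      (by
        simp only [Finset.mem_union, List.mem_toFinset, not_or]
        exact ⟨⟨hFU b (by simp), fun h => hFS b (by simp) (by simp [h])⟩,
          (List.nodup_cons.1 hFn).1⟩)
    obtain ⟨I, hI, hIl⟩ := exists_interior_of_walk hab p
    have hIn := hp.support_nodup
    have hIc := p.isChain_adj_support
    rw [hI] at hIn hIc hpU
    simp only [Finset.mem_union, List.mem_toFinset, not_or] at hpU
    rw [List.nodup_cons, List.nodup_append'] at hIn
    have hIU : ∀ v ∈ I, (v ∉ U ∧ v ∉ S0) ∧ v ∉ F := fun v hv => hpU v (by simp [hv])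
    have hIa : a ∉ I := fun h => hIn.1 (by simp [h])
    have hIb : b ∉ I := fun h => hIn.2.2.2 h (by simp)
    have hIF : (I ++ b :: F).IsChain G.Adj := by
      rw [List.isChain_append]
      have h' := hIc.tail
      simp only [List.tail_cons, List.isChain_append] at h'
      exact ⟨h'.1, hFc, by simpa using h'.2.2⟩
    have hSI : (a :: (I ++ b :: F)).IsChain G.Adj := by
      rw [List.isChain_cons]
      refine ⟨?_, hIF⟩
      have h' := (List.isChain_cons.1 hIc).1
      cases I <;> simpa using h'
    have key : ∀ S', SameEnds G (S0 ++ [a]) S' → SameEnds G (S0 ++ [a] ++ I) (S' ++ I) := by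
      intro S' ⟨k1, k2, k3⟩
      refine ⟨by simp only [List.head?_append, k1], by simp only [List.getLast?_append, k2], ?_⟩
      rw [List.isChain_append]
      refine ⟨k3, (List.isChain_append.1 hIF).1, ?_⟩
      rw [k2]
      have h' := (List.isChain_cons.1 hSI).1
      intro x hx y hy
      simp only [List.getLast?_append, List.getLast?_singleton, Option.some_or, Option.mem_def,
        Option.some.injEq] at hx
      subst hx
      refine h' y ?_
      rw [List.head?_append, Option.mem_def, Option.mem_def.1 hy, Option.some_or]
    refine ⟨(S0 ++ [a] ++ I) :: R', I + E, ?_, ?_, by simp, ?_, ?_, ?_, ?_⟩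
    · rw [List.flatten_cons, hF, List.append_assoc, List.isChain_append]
      refine ⟨hSc, hIF, ?_⟩
      have h' := (List.isChain_cons.1 hSI).1
      intro x hx y hy
      simp only [List.getLast?_append, List.getLast?_singleton, Option.some_or, Option.mem_def,
        Option.some.injEq] at hx
      subst hx
      exact h' y hy
    · rw [List.flatten_cons, hF, List.append_assoc, List.nodup_append', List.nodup_append',
        List.nodup_append']
      refine ⟨hSn, ⟨hIn.2.1, hFn, ?_⟩, ?_⟩
      · intro v hv hv'
        rcases List.mem_cons.1 hv' with rfl | hv'
        · exact hIb hv
        · exact (hIU v hv).2 hv'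
      · intro v hv hv'
        rcases List.mem_append.1 hv' with h | h
        · rcases List.mem_append.1 hv with h0 | h0
          · exact (hIU v h).1.2 h0
          · rw [List.mem_singleton] at h0; exact hIa (h0 ▸ h)
        · exact hFS v h hv
    · intro v hv
      rw [List.flatten_cons, hF] at hv
      rcases List.mem_append.1 hv with h | h
      · rcases List.mem_append.1 h with h | h
        · exact hSU v h
        · exact (hIU v h).1.1
      · exact hFU v h
    · simp only [List.flatten_cons, List.length_append, List.length_cons, List.length_nil]
      have : I.length ≤ K := by omega
      nlinarith
    · rw [List.flatten_cons, ← Multiset.coe_add, h6]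
      simp only [List.flatten_cons, ← Multiset.coe_add]
      abel
    · intro M hM
      obtain ⟨S', N, hS', hN, rfl⟩ := Reroutes.cons_iff.1 hM
      have := (h7 N hN).cons (key S' hS')
      convert this using 1
      simp only [← Multiset.coe_add]
      abel

end PathSystems

end RobustAbsorb

namespace RobustAbsorb

/-! ### Codegree chains and the gadget absorbing a pair -/

section Gadgets

open Classical

variable {V : Type*} [Fintype V]

/-- The number of common neighbours. -/
noncomputable def codeg (G : SimpleGraph V) (a b : V) : ℕ :=
  (Finset.univ.filter fun v => G.Adj a v ∧ G.Adj b v).card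

/-- Two vertices are adjacent when they have at least `D` common neighbours. -/
def codegGraph (G : SimpleGraph V) (D : ℕ) : SimpleGraph V where
  Adj a b := a ≠ b ∧ D ≤ codeg G a b
  symm := ⟨fun a b h => ⟨h.1.symm, by
    have := h.2; simp only [codeg] at this ⊢; simpa only [and_comm] using this⟩⟩
  loopless := ⟨fun _ h => h.1 rfl⟩

variable {G : SimpleGraph V}

theorem exists_common_neighbor {D : ℕ} {a b : V} (h : (codegGraph G D).Adj a b) (U : Finset V)
    (hU : U.card < D) : ∃ c, G.Adj a c ∧ G.Adj b c ∧ c ∉ U := by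
  obtain ⟨c, hc, hcU⟩ := Finset.exists_mem_notMem_of_card_lt_card (lt_of_lt_of_le hU h.2)
  simp only [Finset.mem_filter, Finset.mem_univ, true_and] at hc
  exact ⟨c, hc.1, hc.2, hcU⟩

/-- Each codegree edge `r v` has two fresh common neighbours `c`, `d`; the path `c v d` becomes `c r
d`, which moves the vacancy one step along the chain. The net effect of all the exchanges is to take
in `r` and release `z`, written additively to avoid subtraction of multisets. -/
theorem exists_shift {D : ℕ} {r z : V} (p : (codegGraph G D).Walk r z) (hp : p.IsPath)
    (U : Finset V) (hU : ∀ v ∈ p.support, v ∉ U) (hD : U.card + 3 * p.length + 5 ≤ D) :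
    ∃ (C : List (List V)) (M : Multiset V), IsPathSystem G U C ∧ r ∉ C.flatten ∧
      C.flatten.length ≤ 3 * p.length ∧ Reroutes G C M ∧
      M + {z} = (C.flatten : Multiset V) + {r} := by
  induction p generalizing U with
  | nil => exact ⟨[], 0, ⟨by simp, by simp, by simp, by simp⟩, by simp, by simp, .nil, by simp⟩
  | @cons r v z hrv q ih =>
    rw [SimpleGraph.Walk.cons_isPath_iff] at hp
    simp only [SimpleGraph.Walk.support_cons, List.mem_cons, SimpleGraph.Walk.length_cons] at hU hD ⊢
    have hcU : (insert r U).card ≤ U.card + 1 := Finset.card_insert_le _ _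
    obtain ⟨C, M, hC, hv, hl, hM, hMz⟩ := ih hp.1 (insert r U) (fun v hv => by
      rw [Finset.mem_insert, not_or]
      exact ⟨fun h => hp.2 (h ▸ hv), hU v (Or.inr hv)⟩) (by omega)
    have hcf := C.flatten.toFinset_card_le
    have hc1 := Finset.card_union_le U C.flatten.toFinset
    obtain ⟨c, hrc, hvc, hc⟩ := exists_common_neighbor hrv (U ∪ C.flatten.toFinset) (by omega)
    have hc2 := Finset.card_insert_le c (U ∪ C.flatten.toFinset)
    obtain ⟨d, hrd, hvd, hd⟩ := exists_common_neighbor hrv (insert c (U ∪ C.flatten.toFinset))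
      (by omega)
    simp only [Finset.mem_union, Finset.mem_insert, List.mem_toFinset, not_or] at hc hd
    have hvr : r ≠ v := hrv.1
    have hav := hC.avoid
    simp only [Finset.mem_insert, not_or] at hav
    refine ⟨[c, v, d] :: C, ([c, r, d] : List V) + M, ⟨?_, ?_, ?_, ?_⟩, ?_, ?_, ?_, ?_⟩
    · intro l hl
      rcases List.mem_cons.1 hl with rfl | hl
      · simp
      · exact hC.ne_nil l hl
    · intro l hl
      rcases List.mem_cons.1 hl with rfl | hl
      · simp [hvc.symm, hvd]
      · exact hC.chain l hl
    · rw [List.flatten_cons, List.nodup_append']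
      refine ⟨?_, hC.nodup, ?_⟩
      · have := hvc.ne'
        have := hvd.ne
        have := hd.1
        simp; tauto
      · intro x hx
        simp only [List.mem_cons, List.not_mem_nil, or_false] at hx
        rcases hx with rfl | rfl | rfl
        · exact hc.2
        · exact hv
        · exact hd.2.2
    · intro x hx
      rw [List.flatten_cons, List.mem_append] at hx
      rcases hx with hx | hx
      · simp only [List.mem_cons, List.not_mem_nil, or_false] at hx
        rcases hx with rfl | rfl | rfl
        · exact hc.1
        · exact hU _ (Or.inr q.start_mem_support)
        · exact hd.2.1
      · exact (hav x hx).2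
    · rw [List.flatten_cons, List.mem_append]
      have h1 := hrc.ne
      have h2 := hrd.ne
      have h3 : r ∉ C.flatten := fun h => (hav r h).1 rfl
      simp only [List.mem_cons, List.not_mem_nil, or_false]
      tauto
    · simp only [List.flatten_cons, List.length_append, List.length_cons, List.length_nil]
      omega
    · exact hM.cons ⟨rfl, rfl, by simp [hrc.symm, hrd]⟩
    · rw [add_assoc, hMz]
      simp only [List.flatten_cons, ← Multiset.coe_add, ← Multiset.cons_coe,
        Multiset.coe_nil, ← Multiset.singleton_add]
      abel

/-- Every codegree edge is subdivided by a fresh common neighbour. The resulting path of `G` has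
even length, which is what the parity switch needs. -/
theorem exists_doubled_path {D : ℕ} {r z : V} (p : (codegGraph G D).Walk r z) (hp : p.IsPath)
    (U : Finset V) (hU : ∀ v ∈ p.support, v ∉ U) (hD : U.card + 3 * p.length + 5 ≤ D) :
    ∃ l : List V, (r :: l).IsChain G.Adj ∧ (r :: l).Nodup ∧ (r :: l).getLast? = some z ∧
      l.length = 2 * p.length ∧ ∀ v ∈ r :: l, v ∉ U := by
  induction p generalizing U with
  | nil => exact ⟨[], by simp, by simp, by simp, by simp, by simpa using hU⟩
  | @cons r v z hrv q ih =>
    rw [SimpleGraph.Walk.cons_isPath_iff] at hp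
    simp only [SimpleGraph.Walk.support_cons, List.mem_cons, SimpleGraph.Walk.length_cons] at hU hD ⊢
    have hcU : (insert r U).card ≤ U.card + 1 := Finset.card_insert_le _ _
    obtain ⟨l, h1, h2, h3, h4, h5⟩ := ih hp.1 (insert r U) (fun v hv => by
      rw [Finset.mem_insert, not_or]
      exact ⟨fun h => hp.2 (h ▸ hv), hU v (Or.inr hv)⟩) (by omega)
    have hcf := (v :: l).toFinset_card_le
    have hc1 := Finset.card_union_le U (v :: l).toFinset
    rw [List.length_cons] at hcf
    obtain ⟨c, hrc, hvc, hc⟩ := exists_common_neighbor hrv (U ∪ (v :: l).toFinset) (by omega)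
    simp only [Finset.mem_union, List.mem_toFinset, not_or, Finset.mem_insert] at hc h5
    refine ⟨c :: v :: l, ?_, ?_, ?_, ?_, ?_⟩
    · rw [List.isChain_cons_cons, List.isChain_cons_cons]
      exact ⟨hrc, hvc.symm, h1⟩
    · rw [List.nodup_cons, List.nodup_cons]
      refine ⟨?_, hc.2, h2⟩
      rw [List.mem_cons, not_or]
      exact ⟨hrc.ne, fun h => (h5 r h).1 rfl⟩
    · simpa using h3
    · simp only [List.length_cons]; omega
    · intro x hx
      rcases hx with rfl | hx
      · exact hU _ (Or.inl rfl)
      rcases List.mem_cons.1 hx with rfl | hx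
      · exact hc.1
      · exact (h5 x hx).2

/-- The path system `C` can be rerouted to cover two further vertices `w` and `w'`. -/
def AbsorbsPair (G : SimpleGraph V) (C : List (List V)) (w w' : V) : Prop :=
  Reroutes G C ((C.flatten : Multiset V) + ({w} + {w'}))

/-- A set of six distinct vertices forming two paths `x r y` and `x' r' y'`. -/
structure TwoCherries (G : SimpleGraph V) (U : Finset V) (x r y x' r' y' : V) : Prop where
  nodup : [x, r, y, x', r', y'].Nodup
  avoid : ∀ v ∈ [x, r, y, x', r', y'], v ∉ U
  xr : G.Adj x r
  ry : G.Adj r y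
  xr' : G.Adj x' r'
  ry' : G.Adj r' y'

theorem exists_pair_absorber {D K : ℕ} {U : Finset V} {x r y x' r' y' a b z : V}
    (h : TwoCherries G U x r y x' r' y') (hz : [z, a, b].Nodup)
    (hzU : ∀ v ∈ [z, a, b], v ∉ U ∪ [x, r, y, x', r', y'].toFinset)
    (har : G.Adj a r') (hrz : G.Adj r' z) (hzb : G.Adj z b) (hab : G.Adj a b)
    (p : (codegGraph G D).Walk r z) (hp : p.IsPath) (hpK : p.length ≤ K)
    (hpU : ∀ v ∈ p.support, v ∉ U ∪ [x, y, x', r', y', a, b].toFinset)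
    (hD : U.card + 3 * K + 12 ≤ D) :
    ∃ C, IsPathSystem G U C ∧ C.flatten.length ≤ 3 * K + 8 ∧
      ∀ w w', G.Adj w x → G.Adj w y → G.Adj w' x' → G.Adj w' y' → AbsorbsPair G C w w' := by
  have hcU := Finset.card_union_le U [x, y, x', r', y', a, b].toFinset
  have hc7 := [x, y, x', r', y', a, b].toFinset_card_le
  simp only [List.length_cons, List.length_nil] at hc7
  obtain ⟨C, M, hC, hr, hl, hM, hMz⟩ := exists_shift p hp (U ∪ [x, y, x', r', y', a, b].toFinset)
    hpU (by omega)
  have hn := h.nodup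
  have hav := h.avoid
  refine ⟨[x, r, y] :: [x', r', y'] :: [a, b] :: C, ⟨?_, ?_, ?_, ?_⟩, ?_, ?_⟩
  · intro l hl
    simp only [List.mem_cons] at hl
    rcases hl with rfl | rfl | rfl | hl
    · simp
    · simp
    · simp
    · exact hC.ne_nil l hl
  · intro l hl
    simp only [List.mem_cons] at hl
    rcases hl with rfl | rfl | rfl | hl
    · simp [h.xr, h.ry]
    · simp [h.xr', h.ry']
    · simp [hab]
    · exact hC.chain l hl
  · have h1 : ([x, r, y, x', r', y'] ++ [a, b]).Nodup := by
      rw [List.nodup_append']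
      refine ⟨hn, by simpa using hab.ne, fun v hv hv' => ?_⟩
      have := hzU v (List.mem_cons_of_mem _ hv')
      simp only [Finset.mem_union, List.mem_toFinset, not_or] at this
      exact this.2 hv
    have h2 : (([x, r, y, x', r', y'] ++ [a, b]) ++ C.flatten).Nodup := by
      rw [List.nodup_append']
      refine ⟨h1, hC.nodup, fun v hv hv' => ?_⟩
      have := hC.avoid v hv'
      simp only [Finset.mem_union, List.mem_toFinset, not_or] at this
      simp only [List.cons_append, List.nil_append, List.mem_cons, List.not_mem_nil,
        or_false] at hv
      rcases hv with rfl | rfl | rfl | rfl | rfl | rfl | rfl | rfl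
      · exact this.2 (by simp)
      · exact hr hv'
      all_goals exact this.2 (by simp)
    simpa using h2
  · intro v hv
    simp only [List.flatten_cons, List.mem_append] at hv
    rcases hv with hv | hv | hv | hv
    · exact hav v (List.mem_append_left [x', r', y'] hv)
    · exact hav v (List.mem_append_right [x, r, y] hv)
    · have := hzU v (List.mem_cons_of_mem _ hv)
      simp only [Finset.mem_union, not_or] at this
      exact this.1
    · have := hC.avoid v hv
      simp only [Finset.mem_union, not_or] at this
      exact this.1
  · simp only [List.flatten_cons, List.length_append, List.length_cons, List.length_nil]
    omega
  · intro w w' hx hy hx' hy'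
    -- All exchanges at once: `w` and `w'` displace `r` and `r'`, the shift takes in `r` and gives
    -- out `z`, and the edge `ab` expands to hold `r'` and `z`.
    have key := (((hM.cons (l := [a, b]) (l' := [a, r', z, b]) ⟨rfl, rfl, by
      simp [har, hrz, hzb]⟩).cons (l := [x', r', y']) (l' := [x', w', y']) ⟨rfl, rfl, by
      simp [hx'.symm, hy']⟩).cons (l := [x, r, y]) (l' := [x, w, y]) ⟨rfl, rfl, by
      simp [hx.symm, hy]⟩)
    unfold AbsorbsPair
    convert key using 1
    simp only [List.flatten_cons, ← Multiset.coe_add, ← Multiset.cons_coe, Multiset.coe_nil,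
      ← Multiset.singleton_add, add_zero]
    have e : ∀ S : Multiset V, S + (M + {z}) = S + ((C.flatten : Multiset V) + {r}) := fun S => by
      rw [hMz]
    have := e ({x} + {w} + {y} + {x'} + {w'} + {y'} + {a} + {b} + {r'})
    calc _ = ({x} + {w} + {y} + {x'} + {w'} + {y'} + {a} + {b} + {r'}) +
          ((C.flatten : Multiset V) + {r}) := by abel
      _ = _ := by rw [← this]; abel

end Gadgets

end RobustAbsorb

namespace RobustAbsorb

/-! ### Greedy choice of disjoint gadgets by a potential function -/

section Greedy

open Classical

variable {V : Type*} {G : SimpleGraph V}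

/-- The number of path systems in the list `F` that absorb the pair `w`. -/
noncomputable def hits (G : SimpleGraph V) (F : List (List (List V))) (w : V × V) : ℕ :=
  F.countP fun C => AbsorbsPair G C w.1 w.2

/-- Conditional expectations in place of random sampling: weight each pair by 2^{-hits}. By
averaging over `Ω`, some gadget disjoint from the earlier ones hits at least a `β` fraction of the
weight; the weights hit are at least halved, so the potential shrinks by the factor `1 - β/2`. -/
theorem exists_absorbing_family {Ω : Type*} [Fintype Ω] [Nonempty Ω] (P : Finset (V × V))
    (good : Ω → V × V → Prop) (U₀ : Finset V) {s N : ℕ} {β : ℝ} (hβ : 0 < β)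
    (h : ∀ U : Finset V, U.card ≤ N → ∀ w ∈ P,
      β * Fintype.card Ω ≤ (Finset.univ.filter fun ω => good ω w ∧
        ∃ C, IsPathSystem G (U₀ ∪ U) C ∧ C.flatten.length ≤ s ∧
          ∀ w' ∈ P, good ω w' → AbsorbsPair G C w'.1 w'.2).card) :
    ∀ t : ℕ, t * s ≤ N → ∃ F : List (List (List V)), IsPathSystem G U₀ F.flatten ∧
      F.flatten.flatten.length ≤ t * s ∧
      ∑ w ∈ P, (1 / 2 : ℝ) ^ hits G F w ≤ P.card * (1 - β / 2) ^ t := by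
  rcases P.eq_empty_or_nonempty with rfl | hP
  · exact fun t _ => ⟨[], ⟨by simp, by simp, by simp, by simp⟩, by simp, by simp⟩
  intro t
  induction t with
  | zero =>
    exact fun _ => ⟨[], ⟨by simp, by simp, by simp, by simp⟩, by simp, by simp [hits]⟩
  | succ t ih =>
    intro hN
    rw [add_mul, one_mul] at hN ⊢
    obtain ⟨F, hF, hFl, hΦ⟩ := ih (by omega)
    set g : V × V → ℝ := fun w => (1 / 2 : ℝ) ^ hits G F w with hg
    have hg0 : ∀ w, 0 < g w := fun w => by positivity
    set Φ := ∑ w ∈ P, g w with hΦdef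
    have hΦ0 : 0 < Φ := Finset.sum_pos (fun w _ => hg0 w) hP
    set U := F.flatten.flatten.toFinset with hU
    have hUc : U.card ≤ N := by
      have := F.flatten.flatten.toFinset_card_le
      rw [← hU] at this
      omega
    set valid : Ω → Prop := fun ω => ∃ C, IsPathSystem G (U₀ ∪ U) C ∧ C.flatten.length ≤ s ∧
          ∀ w' ∈ P, good ω w' → AbsorbsPair G C w'.1 w'.2 with hvalid
    have hsum : ∑ _ω : Ω, β * Φ ≤
        ∑ ω : Ω, ∑ w ∈ P, if good ω w ∧ valid ω then g w else 0 := by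
      rw [Finset.sum_comm, Finset.sum_const, Finset.card_univ, nsmul_eq_mul]
      calc (Fintype.card Ω : ℝ) * (β * Φ) = ∑ w ∈ P, β * Fintype.card Ω * g w := by
            rw [← Finset.mul_sum]; ring
        _ ≤ _ := by
            refine Finset.sum_le_sum fun w hw => ?_
            rw [← Finset.sum_filter, Finset.sum_const, nsmul_eq_mul]
            exact mul_le_mul_of_nonneg_right (h U hUc w hw) (hg0 w).le
    obtain ⟨ω, -, hω⟩ := Finset.exists_le_of_sum_le Finset.univ_nonempty hsum
    -- The chosen `ω` gains a positive amount, whereas an invalid one contributes zero.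
    have hv : valid ω := by
      by_contra hv
      simp only [hv, and_false, if_false, Finset.sum_const_zero] at hω
      exact absurd hω (not_le.2 (mul_pos hβ hΦ0))
    simp only [hv, and_true] at hω
    obtain ⟨C, hC, hCs, hCP⟩ := hv
    refine ⟨C :: F, ?_, ?_, ?_⟩
    · rw [List.flatten_cons]
      refine (hC.mono Finset.subset_union_left).append hF fun v hv hv' => ?_
      exact hC.avoid v hv (Finset.mem_union_right _ (List.mem_toFinset.2 hv'))
    · rw [List.flatten_cons, List.flatten_append, List.length_append]
      omega
    · have hstep : ∀ w ∈ P, (1 / 2 : ℝ) ^ hits G (C :: F) w ≤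
          g w - (1 / 2) * (if good ω w then g w else 0) := by
        intro w hw
        split_ifs with hgood
        · have : hits G (C :: F) w = hits G F w + 1 := by
            simp [hits, hCP w hw hgood]
          rw [this, pow_succ]
          simp only [hg]
          linarith
        · have : hits G F w ≤ hits G (C :: F) w := by
            unfold hits
            rw [List.countP_cons]
            omega
          rw [mul_zero, sub_zero]
          exact pow_le_pow_of_le_one (by norm_num) (by norm_num) this
      -- The gain is at most `Φ`, which forces `β ≤ 1`.
      have hβ2 : 0 ≤ 1 - β / 2 := by
        have h1 : ∑ w ∈ P, (if good ω w then g w else 0) ≤ Φ :=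
          Finset.sum_le_sum fun w _ => by
            split_ifs
            · exact le_rfl
            · exact (hg0 w).le
        nlinarith
      calc ∑ w ∈ P, (1 / 2 : ℝ) ^ hits G (C :: F) w
          ≤ ∑ w ∈ P, (g w - (1 / 2) * (if good ω w then g w else 0)) := Finset.sum_le_sum hstep
        _ = Φ - (1 / 2) * ∑ w ∈ P, (if good ω w then g w else 0) := by
            rw [Finset.sum_sub_distrib, Finset.mul_sum]
        _ ≤ Φ * (1 - β / 2) := by linarith
        _ ≤ (P.card * (1 - β / 2) ^ t) * (1 - β / 2) := mul_le_mul_of_nonneg_right hΦ hβ2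
        _ = _ := by ring

/-- Hall's condition in its trivial form: every pair has at least as many gadgets as there are
pairs. Assigning one gadget to the first pair costs each remaining pair at most one of its gadgets.
-/
theorem reroutes_of_hits : ∀ (l : List (V × V)) (F : List (List (List V))),
    (∀ C ∈ F.flatten, C.IsChain G.Adj) → (∀ w ∈ l, l.length ≤ hits G F w) →
    Reroutes G F.flatten ((F.flatten.flatten : Multiset V) +
      ((l.map Prod.fst : List V) + (l.map Prod.snd : List V)))
  | [], F, hF, _ => by simpa using Reroutes.self hF
  | w :: l, F, hF, h => by
    have hw := h w (by simp)
    rw [List.length_cons] at hw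
    have hw' : 0 < F.countP fun C => AbsorbsPair G C w.1 w.2 := by unfold hits at hw; omega
    obtain ⟨C, hCF, hC⟩ := List.countP_pos_iff.1 hw'
    rw [decide_eq_true_iff] at hC
    obtain ⟨A, B, rfl⟩ := List.append_of_mem hCF
    have ih := reroutes_of_hits l (A ++ B)
      (fun C hC => hF C (by
        simp only [List.flatten_append, List.mem_append, List.flatten_cons] at hC ⊢; tauto))
      (fun v hv => by
        have := h v (by simp [hv])
        simp only [hits, List.countP_append, List.countP_cons, List.length_cons] at this ⊢
        split_ifs at this <;> omega)
    rw [List.flatten_append] at ih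
    have := ih.insert hC
    convert this using 1
    · simp
    · simp only [List.flatten_append, List.flatten_cons, List.map_cons, ← Multiset.coe_add,
        ← Multiset.cons_coe, ← Multiset.singleton_add]
      abel

end Greedy

end RobustAbsorb

namespace RobustAbsorb

/-! ### The absorbing path from a system, and the abundance of gadgets -/

section Assembly

open Classical

variable {V : Type*} {G : SimpleGraph V}

theorem exists_walk_of_chain {l : List V} {u v : V} (hl : l.IsChain G.Adj)
    (hu : l.head? = some u) (hv : l.getLast? = some v) : ∃ p : G.Walk u v, p.support = l := by
  have hne : l ≠ [] := by rintro rfl; simp at hu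
  rw [List.head?_eq_some_head hne, Option.some_inj] at hu
  rw [List.getLast?_eq_some_getLast hne, Option.some_inj] at hv
  subst hu hv
  exact ⟨SimpleGraph.Walk.ofSupport l hne hl, SimpleGraph.Walk.support_ofSupport hne hl⟩

theorem exists_path_of_system {D K : ℕ} (hG : ShortlyLinked G D K) {C : List (List V)}
    (hC : C ≠ []) (hC' : IsPathSystem G ∅ C) (hD : (K + 1) * C.flatten.length ≤ D) :
    ∃ (u v : V) (p : G.Walk u v), p.IsPath ∧
      p.support.length ≤ (K + 1) * C.flatten.length ∧
      ∀ W : Finset V, (∀ w ∈ W, w ∉ p.support) →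
        Reroutes G C ((C.flatten : Multiset V) + W.val) → Absorbs G p W := by
  obtain ⟨B, E, h1, h2, h3, -, h5, h6, h7⟩ := exists_link hG C ∅ hC hC' (by simpa using hD)
  obtain ⟨p, hp⟩ := exists_walk_of_chain h1 (List.head?_eq_some_head h3)
    (List.getLast?_eq_some_getLast h3)
  refine ⟨_, _, p, ?_, by rw [hp]; exact h5, ?_⟩
  · rw [SimpleGraph.Walk.isPath_def, hp]; exact h2
  · intro W hW hR
    obtain ⟨B', hB', hM⟩ := h7 _ hR
    obtain ⟨e1, e2, e3⟩ := sameEnds_flatten hB' h1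
    obtain ⟨q, hq⟩ := exists_walk_of_chain e3 (e1.trans (List.head?_eq_some_head h3))
      (e2.trans (List.getLast?_eq_some_getLast h3))
    have hM' : (B'.flatten : Multiset V) = (B.flatten : Multiset V) + W.val := by
      rw [hM, h6]; abel
    refine ⟨q, ?_, ?_⟩
    -- Rerouting does not track distinctness; it is recovered here, as the new list uses exactly the
    -- vertices of the old path together with the disjoint set `W`.
    · rw [SimpleGraph.Walk.isPath_def, hq, ← Multiset.coe_nodup, hM', Multiset.nodup_add]
      refine ⟨h2, W.nodup, ?_⟩
      rw [Multiset.disjoint_left]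
      intro w hw hw'
      exact hW w hw' (by rw [hp]; exact hw)
    · intro z
      rw [hq, hp, ← Multiset.mem_coe, hM', Multiset.mem_add]
      simp

theorem exists_pairing : ∀ (k : ℕ) (l : List V), l.length = 2 * k →
    ∃ P : List (V × V), P.length = k ∧
      (l : Multiset V) = ((P.map Prod.fst : List V) + (P.map Prod.snd : List V))
  | 0, l, h => ⟨[], rfl, by
      have : l = [] := List.length_eq_zero_iff.1 h
      simp [this]⟩
  | k + 1, [], h => by simp at h
  | k + 1, [a], h => by simp only [List.length_cons, List.length_nil] at h; omega
  | k + 1, a :: b :: l, h => by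
    obtain ⟨P, hP, hl⟩ := exists_pairing k l (by simp only [List.length_cons] at h; omega)
    refine ⟨(a, b) :: P, by simp [hP], ?_⟩
    simp only [List.map_cons, ← Multiset.cons_coe, ← Multiset.singleton_add, hl]
    abel

/-- Paths `x r y` of length two outside `U` whose ends are neighbours of `w`. -/
noncomputable def cherries [Fintype V] (G : SimpleGraph V) (U : Finset V) (w : V) :
    Finset (V × V × V) :=
  Finset.univ.filter fun τ => [τ.1, τ.2.1, τ.2.2].Nodup ∧ (∀ v ∈ [τ.1, τ.2.1, τ.2.2], v ∉ U) ∧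
    G.Adj w τ.1 ∧ G.Adj w τ.2.2 ∧ G.Adj τ.1 τ.2.1 ∧ G.Adj τ.2.1 τ.2.2

/-- The vertex `w.1` is adjacent to both ends of the first path `ω.1`, and `w.2` to both ends of the
second path `ω.2`. -/
def Fits (G : SimpleGraph V) (ω : (V × V × V) × (V × V × V)) (w : V × V) : Prop :=
  G.Adj w.1 ω.1.1 ∧ G.Adj w.1 ω.1.2.2 ∧ G.Adj w.2 ω.2.1 ∧ G.Adj w.2 ω.2.2.2

/-- The first cherry can be chosen in `β n³` ways and then a disjoint second one in `β n³` ways;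
each choice completes to a gadget depending only on the cherries, not on the pair. `Adm` unifies the
two cases: it is always true in the first, and in the bipartite one it says that the two vertices
lie on prescribed opposite sides, which is preserved by two steps along edges. -/
theorem many_pair_absorbers [Fintype V] [Nonempty V] {D D' K : ℕ} {β : ℝ} {Adm : V → V → Prop}
    (hβ : 0 < β)
    (hT : ∀ (U : Finset V) (r r' z : V), Adm r r' → G.Adj r' z → U.card ≤ D → r ∉ U → z ∉ U →
      ∃ p : (codegGraph G D').Walk r z, p.IsPath ∧ p.length ≤ K ∧ ∀ v ∈ p.support, v ∉ U)
    (hAdm : ∀ w w' x r x' r', Adm w w' → G.Adj w x → G.Adj x r → G.Adj w' x' → G.Adj x' r' →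
      Adm r r')
    (hcount : ∀ (U : Finset V) (w : V), U.card ≤ D →
      β * (Fintype.card V : ℝ) ^ 3 ≤ (cherries G U w).card)
    (U : Finset V) (hU : U.card + 7 ≤ D) (hD' : U.card + 3 * K + 12 ≤ D') (w : V × V)
    (hw : Adm w.1 w.2) :
    β ^ 2 * Fintype.card ((V × V × V) × (V × V × V)) ≤
      (Finset.univ.filter fun ω : (V × V × V) × (V × V × V) =>
        Fits G ω w ∧ ∃ C, IsPathSystem G U C ∧ C.flatten.length ≤ 3 * K + 8 ∧
          ∀ w' : V × V, Fits G ω w' → AbsorbsPair G C w'.1 w'.2).card := by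
  set S : Finset (Σ _ : V × V × V, V × V × V) := (cherries G U w.1).sigma fun τ =>
    cherries G (U ∪ [τ.1, τ.2.1, τ.2.2].toFinset) w.2 with hS
  have hn : (0 : ℝ) < Fintype.card V := by exact_mod_cast Fintype.card_pos
  have h3 : ∀ τ : V × V × V, (U ∪ [τ.1, τ.2.1, τ.2.2].toFinset).card ≤ U.card + 3 := fun τ =>
    (Finset.card_union_le _ _).trans (by
      have := [τ.1, τ.2.1, τ.2.2].toFinset_card_le
      simpa using this)
  have hcS : β ^ 2 * Fintype.card ((V × V × V) × (V × V × V)) ≤ (S.card : ℝ) := by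
    rw [hS, Finset.card_sigma]
    push_cast
    have h1 : ∑ τ ∈ cherries G U w.1, β * (Fintype.card V : ℝ) ^ 3 ≤
        ∑ τ ∈ cherries G U w.1,
          ((cherries G (U ∪ [τ.1, τ.2.1, τ.2.2].toFinset) w.2).card : ℝ) :=
      Finset.sum_le_sum fun τ _ => hcount _ _ (by have := h3 τ; omega)
    rw [Finset.sum_const, nsmul_eq_mul] at h1
    refine le_trans ?_ h1
    have h2 := hcount U w.1 (by omega)
    simp only [Fintype.card_prod, Nat.cast_mul]
    have := mul_le_mul_of_nonneg_right h2 (by positivity : 0 ≤ β * (Fintype.card V : ℝ) ^ 3)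
    refine le_trans (le_of_eq ?_) this
    ring
  refine hcS.trans ?_
  norm_cast
  refine Finset.card_le_card_of_injOn (fun σ => (σ.1, σ.2)) ?_ ?_
  · rintro ⟨⟨x, r, y⟩, ⟨x', r', y'⟩⟩ hσ
    simp only [hS, Finset.coe_sigma, Set.mem_sigma_iff, Finset.mem_coe, cherries,
      Finset.mem_filter, Finset.mem_univ, true_and] at hσ
    obtain ⟨⟨n1, a1, wx, wy, xr, ry⟩, ⟨n2, a2, wx', wy', xr', ry'⟩⟩ := hσ
    simp only [Finset.coe_filter, Finset.mem_univ, true_and, Set.mem_ofPred_eq]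
    refine ⟨⟨wx, wy, wx', wy'⟩, ?_⟩
    have hch : TwoCherries G U x r y x' r' y' := by
      refine ⟨?_, ?_, xr, ry, xr', ry'⟩
      · have : ([x, r, y] ++ [x', r', y']).Nodup := by
          rw [List.nodup_append']
          exact ⟨n1, n2, fun v h1 h2 =>
            a2 v h2 (Finset.mem_union_right _ (List.mem_toFinset.2 h1))⟩
        exact this
      · intro v hv
        rcases List.mem_append.1 (show v ∈ [x, r, y] ++ [x', r', y'] from hv) with h | h
        · exact a1 v h
        · exact fun h' => a2 v h (Finset.mem_union_left _ h')
    have h6 : (U ∪ [x, r, y, x', r', y'].toFinset).card ≤ U.card + 6 :=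
      (Finset.card_union_le _ _).trans (by
        have := [x, r, y, x', r', y'].toFinset_card_le
        simpa using this)
    -- A cherry `z b a` at `r'` is a 4-cycle through `r'`, and supplies both the edge `ab` and its
    -- detour `a r' z b`.
    have hpos : 0 < (cherries G (U ∪ [x, r, y, x', r', y'].toFinset) r').card := by
      have := hcount (U ∪ [x, r, y, x', r', y'].toFinset) r' (by omega)
      have h0 : 0 < β * (Fintype.card V : ℝ) ^ 3 := by positivity
      exact_mod_cast h0.trans_le this
    obtain ⟨⟨z, b, a⟩, hτ⟩ := Finset.card_pos.1 hpos
    simp only [cherries, Finset.mem_filter, Finset.mem_univ, true_and] at hτ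
    obtain ⟨n3, a3, rz, ra, zb, ba⟩ := hτ
    have h7 : (U ∪ [x, y, x', r', y', a, b].toFinset).card ≤ U.card + 7 :=
      (Finset.card_union_le _ _).trans (by
        have := [x, y, x', r', y', a, b].toFinset_card_le
        simpa using this)
    have hzabU : ∀ v ∈ [z, a, b], v ∉ U ∪ [x, r, y, x', r', y'].toFinset := fun v hv =>
      a3 v (by simp only [List.mem_cons, List.not_mem_nil, or_false] at hv ⊢; tauto)
    have hnz : [z, a, b].Nodup := by
      simp only [List.nodup_cons, List.mem_cons, List.not_mem_nil, or_false, not_or] at n3 ⊢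
      exact ⟨⟨n3.1.2, n3.1.1⟩, ⟨fun h => n3.2.1 h.symm, n3.2.2⟩⟩
    have hr6 := hch.nodup
    have hrU : r ∉ U := hch.avoid r (by simp)
    obtain ⟨p, hp, hpK, hpU⟩ := hT (U ∪ [x, y, x', r', y', a, b].toFinset) r r' z
      (hAdm _ _ _ _ _ _ hw wx xr wx' xr') rz (by omega)
      (by
        have ea : a ≠ r := fun h => hzabU a (by simp) (by simp [h])
        have eb : b ≠ r := fun h => hzabU b (by simp) (by simp [h])
        simp only [List.nodup_cons, List.mem_cons, List.not_mem_nil, or_false, not_or] at hr6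
        simp only [Finset.mem_union, List.mem_toFinset, List.mem_cons, List.not_mem_nil,
          or_false, not_or]
        exact ⟨hrU, fun h => hr6.1.1 h.symm, hr6.2.1.1, hr6.2.1.2.1, hr6.2.1.2.2.1,
          hr6.2.1.2.2.2, ea.symm, eb.symm⟩)
      (by
        have hz := hzabU z (by simp)
        simp only [List.nodup_cons, List.mem_cons, List.not_mem_nil, or_false, not_or] at hnz
        simp only [Finset.mem_union, List.mem_toFinset, List.mem_cons, List.not_mem_nil,
          or_false, not_or] at hz ⊢
        tauto)
    obtain ⟨C, hC, hCl, hCa⟩ := exists_pair_absorber hch hnz hzabU ra.symm rz zb ba.symm p hp hpK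
      hpU hD'
    exact ⟨C, hC, hCl, fun w' ⟨e1, e2, e3, e4⟩ => hCa _ _ e1 e2 e3 e4⟩
  · rintro ⟨a, b⟩ _ ⟨c, d⟩ _ h
    simp only [Prod.mk.injEq] at h
    obtain ⟨rfl, rfl⟩ := h
    rfl

end Assembly

end RobustAbsorb

namespace RobustAbsorb

/-! ### Short walks, and the structure forced by small codegrees -/

section Connectivity

open Classical

variable {V : Type*}

/-- Breadth-first search from `a` outside `U`. If `b` is not reached in `K` steps, not all layers
can have more than `D` vertices; adding a thin layer to `U` gives a separator of size at most `|U| +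
D`, which the hypothesis `h` forbids. -/
theorem exists_short_walk [Fintype V] (R : SimpleGraph V) {D K : ℕ} (hK : Fintype.card V < K * (D + 1))
    (U : Finset V) (a b : V) (ha : a ∉ U) (hb : b ∉ U)
    (h : ∀ A U' : Finset V, U'.card ≤ U.card + D → a ∈ A → b ∉ A → b ∉ U' → Disjoint A U' →
      ∃ x ∈ A, ∃ y, y ∉ A ∧ y ∉ U' ∧ R.Adj x y) :
    ∃ p : R.Walk a b, p.IsPath ∧ p.length ≤ K ∧ ∀ v ∈ p.support, v ∉ U := by
  set B : ℕ → Finset V := fun i => Finset.univ.filter fun v =>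
    ∃ p : R.Walk a v, p.length ≤ i ∧ ∀ x ∈ p.support, x ∉ U with hB
  have memB : ∀ i v, v ∈ B i ↔ ∃ p : R.Walk a v, p.length ≤ i ∧ ∀ x ∈ p.support, x ∉ U := by
    intro i v; simp [hB]
  have hmono : ∀ i j, i ≤ j → B i ⊆ B j := by
    intro i j hij v hv
    obtain ⟨p, hp, hp'⟩ := (memB i v).1 hv
    exact (memB j v).2 ⟨p, hp.trans hij, hp'⟩
  have hBU : ∀ i, ∀ v ∈ B i, v ∉ U := by
    intro i v hv
    obtain ⟨p, -, hp'⟩ := (memB i v).1 hv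
    exact hp' v p.end_mem_support
  by_cases hbK : b ∈ B K
  · obtain ⟨p, hp, hp'⟩ := (memB K b).1 hbK
    exact ⟨p.bypass, p.bypass_isPath, p.length_bypass_le_length.trans hp,
      fun v hv => hp' v (p.support_bypass_subset_support hv)⟩
  exfalso
  have hgrow : ∀ i, i ≤ K → i * (D + 1) ≤ (B i).card := by
    intro i
    induction i with
    | zero => simp
    | succ i ih =>
      intro hi
      have ih := ih (by omega)
      have hsub : B i ⊆ B (i + 1) := hmono _ _ (by omega)
      have hcard := Finset.card_sdiff_add_card_eq_card hsub
      suffices D + 1 ≤ (B (i + 1) \ B i).card by rw [add_mul, one_mul]; omega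
      by_contra hlt
      obtain ⟨x, hx, y, hyA, hyU, hxy⟩ := h (B i) (U ∪ (B (i + 1) \ B i))
        ((Finset.card_union_le _ _).trans (by omega))
        ((memB i a).2 ⟨.nil, by simp, by simpa using ha⟩)
        (fun hb' => hbK (hmono i K (by omega) hb'))
        (by
          rw [Finset.mem_union, not_or]
          exact ⟨hb, fun hb' => hbK (hmono _ _ hi (Finset.mem_sdiff.1 hb').1)⟩)
        (by
          rw [Finset.disjoint_union_right]
          exact ⟨Finset.disjoint_left.2 fun v hv => hBU i v hv, Finset.disjoint_sdiff⟩)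
      rw [Finset.mem_union, not_or] at hyU
      refine hyU.2 (Finset.mem_sdiff.2 ⟨?_, hyA⟩)
      obtain ⟨p, hp, hp'⟩ := (memB i x).1 hx
      refine (memB _ y).2 ⟨p.concat hxy, by rw [SimpleGraph.Walk.length_concat]; omega, ?_⟩
      intro v hv
      rw [SimpleGraph.Walk.support_concat, List.mem_append,
        List.mem_singleton] at hv
      rcases hv with hv | rfl
      · exact hp' v hv
      · exact hyU.1
  have := hgrow K le_rfl
  have := Finset.card_le_univ (B K)
  omega

/-- The adjacency indicator. -/
noncomputable def adjInd (G : SimpleGraph V) (v w : V) : ℝ := if G.Adj v w then 1 else 0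

/-- The number of neighbours of `v` in `S`. -/
noncomputable def nbrs (G : SimpleGraph V) (S : Finset V) (v : V) : ℝ := ∑ w ∈ S, adjInd G v w

/-- The number of pairs in `S × T` that are adjacent. -/
noncomputable def pairs (G : SimpleGraph V) (S T : Finset V) : ℝ := ∑ v ∈ S, nbrs G T v

variable {G : SimpleGraph V}

theorem adjInd_nonneg (v w : V) : 0 ≤ adjInd G v w := by unfold adjInd; split_ifs <;> norm_num

theorem adjInd_le_one (v w : V) : adjInd G v w ≤ 1 := by unfold adjInd; split_ifs <;> norm_num

theorem adjInd_comm (v w : V) : adjInd G v w = adjInd G w v := by simp [adjInd, G.adj_comm]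

theorem nbrs_nonneg (S : Finset V) (v : V) : 0 ≤ nbrs G S v :=
  Finset.sum_nonneg fun _ _ => adjInd_nonneg _ _

theorem nbrs_le_card (S : Finset V) (v : V) : nbrs G S v ≤ S.card := by
  unfold nbrs
  calc _ ≤ ∑ _w ∈ S, (1 : ℝ) := Finset.sum_le_sum fun _ _ => adjInd_le_one _ _
    _ = _ := by simp

theorem nbrs_mono {S T : Finset V} (h : S ⊆ T) (v : V) : nbrs G S v ≤ nbrs G T v :=
  Finset.sum_le_sum_of_subset_of_nonneg h fun _ _ _ => adjInd_nonneg _ _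

theorem nbrs_union_le (S T : Finset V) (v : V) : nbrs G (S ∪ T) v ≤ nbrs G S v + nbrs G T v := by
  have := Finset.sum_union_inter (s₁ := S) (s₂ := T) (f := adjInd G v)
  have h2 : 0 ≤ ∑ w ∈ S ∩ T, adjInd G v w := Finset.sum_nonneg fun _ _ => adjInd_nonneg _ _
  unfold nbrs
  linarith

theorem pairs_nonneg (S T : Finset V) : 0 ≤ pairs G S T :=
  Finset.sum_nonneg fun _ _ => nbrs_nonneg _ _

theorem pairs_comm (S T : Finset V) : pairs G S T = pairs G T S := by
  unfold pairs nbrs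
  rw [Finset.sum_comm]
  exact Finset.sum_congr rfl fun _ _ => Finset.sum_congr rfl fun _ _ => adjInd_comm _ _

theorem pairs_mono {S S' T T' : Finset V} (h : S ⊆ S') (h' : T ⊆ T') :
    pairs G S T ≤ pairs G S' T' :=
  (Finset.sum_le_sum fun v _ => nbrs_mono h' v).trans
    (Finset.sum_le_sum_of_subset_of_nonneg h fun _ _ _ => nbrs_nonneg _ _)

theorem pairs_union_right_le (S T T' : Finset V) :
    pairs G S (T ∪ T') ≤ pairs G S T + pairs G S T' := by
  unfold pairs
  rw [← Finset.sum_add_distrib]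
  exact Finset.sum_le_sum fun v _ => nbrs_union_le _ _ _

theorem pairs_union_left_le (S S' T : Finset V) :
    pairs G (S ∪ S') T ≤ pairs G S T + pairs G S' T := by
  rw [pairs_comm, pairs_comm S, pairs_comm S']
  exact pairs_union_right_le _ _ _

theorem pairs_le_card_mul (S T : Finset V) : pairs G S T ≤ S.card * T.card := by
  unfold pairs
  calc _ ≤ ∑ _v ∈ S, (T.card : ℝ) := Finset.sum_le_sum fun _ _ => nbrs_le_card _ _
    _ = _ := by simp

variable [Fintype V]

theorem codeg_eq_sum (v w : V) : (codeg G v w : ℝ) = ∑ u, adjInd G v u * adjInd G w u := by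
  unfold codeg adjInd
  rw [Finset.card_filter]
  push_cast
  exact Finset.sum_congr rfl fun u _ => by
    by_cases h1 : G.Adj v u <;> by_cases h2 : G.Adj w u <;> simp [h1, h2]

theorem codeg_le_card (v w : V) : (codeg G v w : ℝ) ≤ Fintype.card V := by
  unfold codeg
  exact_mod_cast Finset.card_le_univ _

/-- Minimum degree at least `a n` and at least `a |X| |V ∖ X|` edges across every cut. -/
structure Expands (G : SimpleGraph V) (a : ℝ) : Prop where
  deg : ∀ v, a * Fintype.card V ≤ nbrs G Finset.univ v
  cut : ∀ X : Finset V, a * X.card * (Xᶜ).card ≤ pairs G X Xᶜ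

theorem sum_codeg {a : ℝ} (ha : 0 ≤ a) (hG : Expands G a) (x : V) :
    a ^ 2 * (Fintype.card V : ℝ) ^ 2 ≤ ∑ w, (codeg G x w : ℝ) := by
  have h1 : ∑ w, (codeg G x w : ℝ) = ∑ u, adjInd G x u * nbrs G Finset.univ u := by
    simp only [codeg_eq_sum, nbrs, Finset.mul_sum]
    rw [Finset.sum_comm]
    exact Finset.sum_congr rfl fun u _ => Finset.sum_congr rfl fun w _ => by
      rw [adjInd_comm w u]
  rw [h1]
  have h2 : ∑ u, adjInd G x u * (a * Fintype.card V) ≤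
      ∑ u, adjInd G x u * nbrs G Finset.univ u :=
    Finset.sum_le_sum fun u _ => mul_le_mul_of_nonneg_left (hG.deg u) (adjInd_nonneg _ _)
  rw [← Finset.sum_mul] at h2
  have h3 := hG.deg x
  have h4 : 0 ≤ a * (Fintype.card V : ℝ) := by positivity
  have h5 := mul_le_mul_of_nonneg_right h3 h4
  unfold nbrs at h5
  nlinarith

/-- The codegrees at `x` sum to at least `a² n²`; `B` and `U` account for little of this, so the
rest comes from `A`, each of whose vertices contributes at most `n`. -/
theorem card_side_lower {a γ ε : ℝ} (ha : 0 ≤ a) (hG : Expands G a) {A B U : Finset V}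
    (hcov : A ∪ B ∪ U = Finset.univ) (hU : (U.card : ℝ) ≤ ε * Fintype.card V) {x : V}
    (hγ : 0 ≤ γ) (hcd : ∀ y ∈ B, (codeg G x y : ℝ) ≤ γ * Fintype.card V) :
    (a ^ 2 - γ - ε) * Fintype.card V ≤ A.card := by
  set n : ℝ := (Fintype.card V : ℝ) with hn
  have hn0 : 0 < n := by
    have : Nonempty V := ⟨x⟩
    exact Nat.cast_pos.2 Fintype.card_pos
  have h1 := sum_codeg ha hG x
  have hpos : ∀ S : Finset V, ∀ w ∈ S, (0 : ℝ) ≤ codeg G x w := fun _ _ _ => Nat.cast_nonneg _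
  have h2 : ∑ w, (codeg G x w : ℝ) ≤ A.card * n + B.card * (γ * n) + U.card * n := by
    rw [← hcov]
    have e1 := Finset.sum_union_inter (s₁ := A ∪ B) (s₂ := U) (f := fun w => (codeg G x w : ℝ))
    have e2 := Finset.sum_union_inter (s₁ := A) (s₂ := B) (f := fun w => (codeg G x w : ℝ))
    have e3 := Finset.sum_nonneg (hpos ((A ∪ B) ∩ U))
    have e4 := Finset.sum_nonneg (hpos (A ∩ B))
    have e5 : ∑ w ∈ A, (codeg G x w : ℝ) ≤ A.card * n := by
      rw [← nsmul_eq_mul]; exact Finset.sum_le_card_nsmul _ _ _ fun w _ => codeg_le_card _ _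
    have e6 : ∑ w ∈ U, (codeg G x w : ℝ) ≤ U.card * n := by
      rw [← nsmul_eq_mul]; exact Finset.sum_le_card_nsmul _ _ _ fun w _ => codeg_le_card _ _
    have e7 : ∑ w ∈ B, (codeg G x w : ℝ) ≤ B.card * (γ * n) := by
      rw [← nsmul_eq_mul]; exact Finset.sum_le_card_nsmul _ _ _ hcd
    linarith
  have hB : (B.card : ℝ) ≤ n := by rw [hn]; exact_mod_cast Finset.card_le_univ B
  have h3 : (B.card : ℝ) * (γ * n) ≤ n * (γ * n) := mul_le_mul_of_nonneg_right hB (by positivity)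
  have h4 : (U.card : ℝ) * n ≤ ε * n * n := mul_le_mul_of_nonneg_right hU hn0.le
  have h5 : (a ^ 2 - γ - ε) * n * n ≤ A.card * n := by rw [← hn] at h1; nlinarith
  exact le_of_mul_le_mul_right h5 hn0

/-- Edges leaving `A ∩ P` go to `A ∩ Q`, `B` or `U`, and all three kinds are few. The complement of
`A ∩ P` contains the large set `B`, so expansion makes `A ∩ P` small. The rest of `A` lies in `Q`
and sends few edges to `A`. -/
theorem pairs_side_upper {a γ ε δ : ℝ} (ha : 0 < a) (hδ : 0 < δ) (hG : Expands G a)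
    {A B U P Q : Finset V} (hAB : Disjoint A B) (hcov : A ∪ B ∪ U = Finset.univ)
    (hU : (U.card : ℝ) ≤ ε * Fintype.card V) (hPQ : P ∪ Q = Finset.univ)
    (h : pairs G P B + pairs G Q A ≤ γ * (Fintype.card V : ℝ) ^ 2)
    (hB : δ * Fintype.card V ≤ B.card) :
    pairs G A A ≤ ((γ + ε) / (a * δ) + γ) * (Fintype.card V : ℝ) ^ 2 := by
  set n : ℝ := (Fintype.card V : ℝ) with hn
  have hn0 : 0 ≤ n := Nat.cast_nonneg _
  have hA1n : ((A ∩ P).card : ℝ) ≤ n := by rw [hn]; exact_mod_cast Finset.card_le_univ _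
  have hAn : (A.card : ℝ) ≤ n := by rw [hn]; exact_mod_cast Finset.card_le_univ _
  have hQA := pairs_nonneg (G := G) Q A
  have hPB := pairs_nonneg (G := G) P B
  have hA : A ⊆ (A ∩ P) ∪ (A ∩ Q) := by
    rw [← Finset.inter_union_distrib_left, hPQ, Finset.inter_univ]
  have h1 : pairs G (A ∩ P) (A ∩ P)ᶜ ≤ (γ + ε) * n ^ 2 := by
    have hsub : (A ∩ P)ᶜ ⊆ ((A ∩ Q) ∪ B) ∪ U := by
      intro v hv
      have hv1 : v ∈ A ∪ B ∪ U := by rw [hcov]; exact Finset.mem_univ v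
      have hv2 : v ∈ P ∪ Q := by rw [hPQ]; exact Finset.mem_univ v
      simp only [Finset.mem_compl, Finset.mem_inter, Finset.mem_union] at hv hv1 hv2 ⊢
      tauto
    have e1 := pairs_mono (G := G) (Finset.Subset.refl (A ∩ P)) hsub
    have e2 := pairs_union_right_le (G := G) (A ∩ P) ((A ∩ Q) ∪ B) U
    have e3 := pairs_union_right_le (G := G) (A ∩ P) (A ∩ Q) B
    have e4 : pairs G (A ∩ P) (A ∩ Q) ≤ pairs G Q A := by
      rw [pairs_comm Q A]
      exact pairs_mono Finset.inter_subset_left Finset.inter_subset_right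
    have e5 : pairs G (A ∩ P) B ≤ pairs G P B :=
      pairs_mono Finset.inter_subset_right (Finset.Subset.refl _)
    have e6 := pairs_le_card_mul (G := G) (A ∩ P) U
    have e7 : ((A ∩ P).card : ℝ) * U.card ≤ n * (ε * n) :=
      mul_le_mul hA1n hU (Nat.cast_nonneg _) hn0
    nlinarith
  have h2 := hG.cut (A ∩ P)
  have h3 : (B.card : ℝ) ≤ ((A ∩ P)ᶜ).card := by
    exact_mod_cast Finset.card_le_card fun v hv => by
      simp only [Finset.mem_compl, Finset.mem_inter, not_and]
      exact fun hvA => absurd hv (Finset.disjoint_left.1 hAB hvA)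
  have h4 : ((A ∩ P).card : ℝ) * n ≤ (γ + ε) / (a * δ) * n ^ 2 := by
    rcases hn0.eq_or_lt with h0 | h0
    · rw [← h0]; simp
    have h5 : a * ((A ∩ P).card : ℝ) * (δ * n) ≤ (γ + ε) * n ^ 2 :=
      (mul_le_mul_of_nonneg_left (hB.trans h3) (by positivity)).trans (h2.trans h1)
    rw [div_mul_eq_mul_div, le_div_iff₀ (by positivity)]
    nlinarith
  have h6 : pairs G A A ≤ pairs G (A ∩ P) A + pairs G (A ∩ Q) A :=
    (pairs_mono hA (Finset.Subset.refl _)).trans (pairs_union_left_le _ _ _)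
  have h7 : pairs G (A ∩ P) A ≤ (A ∩ P).card * n :=
    (pairs_le_card_mul _ _).trans (mul_le_mul_of_nonneg_left hAn (Nat.cast_nonneg _))
  have h8 : pairs G (A ∩ Q) A ≤ pairs G Q A :=
    pairs_mono Finset.inter_subset_right (Finset.Subset.refl _)
  rw [add_mul]
  linarith

/-- Double counting turns small codegrees across `(A, B)` into a bound on Σ d_A(v) d_B(v), hence on
Σ min(d_A(v), d_B(v)). Classify the vertices by their majority side, `P` towards `A` and `Q` towards
`B`; the minority edges are few, and `pairs_side_upper` applies to both sides. -/
theorem pairs_separated_upper {a γ ε : ℝ} (ha : 0 < a) (hγ : 0 < γ) (hε : ε ≤ a / 2)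
    (hγε : γ + ε ≤ a ^ 2 / 2) (hG : Expands G a) {A B U : Finset V} (hAB : Disjoint A B)
    (hcov : A ∪ B ∪ U = Finset.univ) (hU : (U.card : ℝ) ≤ ε * Fintype.card V)
    (hA : A.Nonempty) (hB : B.Nonempty)
    (hcd : ∀ x ∈ A, ∀ y ∈ B, (codeg G x y : ℝ) ≤ γ * Fintype.card V) :
    pairs G A A ≤ ((4 * γ / a + ε) / (a * (a ^ 2 / 2)) + 4 * γ / a) * (Fintype.card V : ℝ) ^ 2 ∧
    pairs G B B ≤ ((4 * γ / a + ε) / (a * (a ^ 2 / 2)) + 4 * γ / a) * (Fintype.card V : ℝ) ^ 2 := by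
  set n : ℝ := (Fintype.card V : ℝ) with hn
  obtain ⟨x, hx⟩ := hA
  obtain ⟨y, hy⟩ := hB
  have hn0 : 0 < n := by
    have : Nonempty V := ⟨x⟩
    exact Nat.cast_pos.2 Fintype.card_pos
  have hcov' : B ∪ A ∪ U = Finset.univ := by rw [Finset.union_comm B, hcov]
  have hcA : a ^ 2 / 2 * n ≤ A.card := le_trans
    (mul_le_mul_of_nonneg_right (by linarith) hn0.le)
    (card_side_lower ha.le hG hcov hU hγ.le (hcd x hx))
  have hcB : a ^ 2 / 2 * n ≤ B.card := le_trans
    (mul_le_mul_of_nonneg_right (by linarith) hn0.le)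
    (card_side_lower (x := y) ha.le hG hcov' hU hγ.le fun z hz => by
      have := hcd z hz y hy
      simp only [codeg] at this ⊢
      simpa only [and_comm] using this)
  have hprod : ∑ v, nbrs G A v * nbrs G B v ≤ γ * n ^ 3 := by
    have e1 : ∑ v, nbrs G A v * nbrs G B v = ∑ x ∈ A, ∑ y ∈ B, (codeg G x y : ℝ) := by
      simp only [codeg_eq_sum, nbrs, Finset.sum_mul_sum]
      rw [Finset.sum_comm]
      refine Finset.sum_congr rfl fun x _ => ?_
      rw [Finset.sum_comm]
      exact Finset.sum_congr rfl fun y _ => Finset.sum_congr rfl fun v _ => by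
        rw [adjInd_comm v x, adjInd_comm v y]
    have e2 : ∑ x ∈ A, ∑ y ∈ B, (codeg G x y : ℝ) ≤ ∑ _x ∈ A, ∑ _y ∈ B, γ * n :=
      Finset.sum_le_sum fun x hx => Finset.sum_le_sum fun y hy => hcd x hx y hy
    rw [Finset.sum_const, Finset.sum_const, nsmul_eq_mul, nsmul_eq_mul] at e2
    have hA' : (A.card : ℝ) ≤ n := by rw [hn]; exact_mod_cast Finset.card_le_univ _
    have hB' : (B.card : ℝ) ≤ n := by rw [hn]; exact_mod_cast Finset.card_le_univ _
    have e3 : (A.card : ℝ) * (B.card * (γ * n)) ≤ n * (n * (γ * n)) :=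
      mul_le_mul hA' (mul_le_mul_of_nonneg_right hB' (by positivity)) (by positivity) hn0.le
    rw [e1]
    nlinarith
  -- At most `ε n ≤ a n / 2` neighbours are lost in `U`, so the larger of the two degrees is at
  -- least `a n / 4`.
  have hmin : ∀ v, min (nbrs G A v) (nbrs G B v) * (a / 4 * n) ≤ nbrs G A v * nbrs G B v := by
    intro v
    have d1 := hG.deg v
    rw [← hcov] at d1
    have d2 := nbrs_union_le (G := G) (A ∪ B) U v
    have d3 := nbrs_union_le (G := G) A B v
    have d4 := nbrs_le_card (G := G) U v
    have d5 : a / 2 * n ≤ nbrs G A v + nbrs G B v := by nlinarith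
    have d6 := nbrs_nonneg (G := G) A v
    have d7 := nbrs_nonneg (G := G) B v
    rcases le_total (nbrs G A v) (nbrs G B v) with h | h
    · rw [min_eq_left h]
      exact mul_le_mul_of_nonneg_left (by linarith) d6
    · rw [min_eq_right h, mul_comm (nbrs G A v)]
      exact mul_le_mul_of_nonneg_left (by linarith) d7
  have hsum : ∑ v, min (nbrs G A v) (nbrs G B v) ≤ 4 * γ / a * n ^ 2 := by
    have e1 := (Finset.sum_le_sum fun v (_ : v ∈ Finset.univ) => hmin v).trans hprod
    rw [← Finset.sum_mul] at e1
    have e2 : (4 * γ / a * n ^ 2) * (a / 4 * n) = γ * n ^ 3 := by field_simp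
    rw [← e2] at e1
    exact le_of_mul_le_mul_right e1 (by positivity)
  set P := Finset.univ.filter fun v => nbrs G B v ≤ nbrs G A v with hP
  set Q := Finset.univ.filter fun v => ¬ nbrs G B v ≤ nbrs G A v with hQ
  have hPQ : P ∪ Q = Finset.univ := Finset.filter_union_filter_not_eq _ _
  have hPQs : pairs G P B + pairs G Q A ≤ 4 * γ / a * n ^ 2 := by
    refine le_trans (le_of_eq ?_) hsum
    rw [← Finset.sum_filter_add_sum_filter_not Finset.univ (fun v => nbrs G B v ≤ nbrs G A v)
      (fun v => min (nbrs G A v) (nbrs G B v))]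
    unfold pairs
    congr 1
    · exact Finset.sum_congr rfl fun v hv => (min_eq_right (Finset.mem_filter.1 hv).2).symm
    · exact Finset.sum_congr rfl fun v hv =>
        (min_eq_left (not_le.1 (Finset.mem_filter.1 hv).2).le).symm
  exact ⟨pairs_side_upper ha (by positivity) hG hAB hcov hU hPQ hPQs hcB,
    pairs_side_upper ha (by positivity) hG hAB.symm hcov' hU (by rw [Finset.union_comm, hPQ])
      (by rw [add_comm]; exact hPQs) hcA⟩

end Connectivity

end RobustAbsorb

namespace RobustAbsorb

/-! ### Linking in the graph and in its codegree graph; counting cherries -/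

section Linking

open Classical

variable {V : Type*} [Fintype V] {G : SimpleGraph V}

/-- If `U'` separates `A` from `y`, every edge leaving `A` ends in `U'`, so expansion gives `a |Aᶜ|
≤ |U'|`. All neighbours of `y` lie in `Aᶜ`, so `|U'| ≥ a² n`, which exceeds `2D`. -/
theorem Expands.shortlyLinked {a : ℝ} {D K : ℕ} (ha : 0 < a) (hG : Expands G a)
    (hD : (2 * D : ℝ) < a ^ 2 * Fintype.card V) (hK : Fintype.card V < K * (D + 1)) :
    ShortlyLinked G D K := by
  intro U x y hU hx hy
  refine exists_short_walk G hK U x y hx hy fun A U' hU' hxA hyA hyU' hAU' => ?_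
  by_contra hno
  push Not at hno
  have hU2 : (U'.card : ℝ) ≤ 2 * D := by exact_mod_cast (by omega : U'.card ≤ 2 * D)
  have hzero : ∀ v ∈ A, ∀ w, w ∉ A → w ∉ U' → adjInd G v w = 0 := fun v hv w hw hw' => by
    simp [adjInd, hno v hv w hw hw']
  have h1 : pairs G A Aᶜ ≤ A.card * U'.card := by
    refine le_trans ?_ (pairs_le_card_mul (G := G) A U')
    refine Finset.sum_le_sum fun v hv => ?_
    unfold nbrs
    rw [← Finset.sum_filter_add_sum_filter_not Aᶜ (· ∈ U')]
    rw [Finset.sum_eq_zero (s := Finset.filter (fun w => w ∉ U') Aᶜ), add_zero]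
    · exact Finset.sum_le_sum_of_subset_of_nonneg (fun w hw => (Finset.mem_filter.1 hw).2)
        fun _ _ _ => adjInd_nonneg _ _
    · intro w hw
      rw [Finset.mem_filter, Finset.mem_compl] at hw
      exact hzero v hv w hw.1 hw.2
  have h2 : nbrs G Finset.univ y ≤ (Aᶜ).card := by
    refine le_trans ?_ (nbrs_le_card (G := G) Aᶜ y)
    unfold nbrs
    rw [← Finset.sum_add_sum_compl A, Finset.sum_eq_zero, zero_add]
    intro v hv
    rw [adjInd_comm]
    exact hzero v hv y hyA hyU'
  have h3 := hG.cut A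
  have h4 := hG.deg y
  have hApos : (0 : ℝ) < A.card := Nat.cast_pos.2 (Finset.card_pos.2 ⟨x, hxA⟩)
  have h5 : a * (Aᶜ).card ≤ U'.card := by
    refine le_of_mul_le_mul_left ?_ hApos
    linarith
  have h6 : a * (a * Fintype.card V) ≤ a * (Aᶜ).card :=
    mul_le_mul_of_nonneg_left (h4.trans h2) ha.le
  nlinarith

theorem codeg_lt_of_not_adj {D : ℕ} {x y : V} (hxy : x ≠ y) (h : ¬ (codegGraph G D).Adj x y) :
    codeg G x y < D := by
  by_contra h'
  exact h ⟨hxy, not_lt.1 h'⟩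

theorem Expands.codeg_linked {a γ ε c : ℝ} {D D' K : ℕ} (ha : 0 < a) (hγ : 0 < γ)
    (hε : ε ≤ a / 2) (hγε : γ + ε ≤ a ^ 2 / 2)
    (hc : (4 * γ / a + ε) / (a * (a ^ 2 / 2)) + 4 * γ / a + 2 * ε < c) (hG : Expands G a)
    (hX : ∀ X : Finset V, c * (Fintype.card V : ℝ) ^ 2 ≤ pairs G X X ∨
      c * (Fintype.card V : ℝ) ^ 2 ≤ pairs G Xᶜ Xᶜ)
    (hD : (2 * D : ℝ) ≤ ε * Fintype.card V) (hD' : (D' : ℝ) ≤ γ * Fintype.card V)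
    (hK : Fintype.card V < K * (D + 1)) (U : Finset V) (x y : V) (hU : U.card ≤ D) (hx : x ∉ U)
    (hy : y ∉ U) :
    ∃ p : (codegGraph G D').Walk x y, p.IsPath ∧ p.length ≤ K ∧ ∀ v ∈ p.support, v ∉ U := by
  refine exists_short_walk _ hK U x y hx hy fun A U' hU' hxA hyA hyU' hAU' => ?_
  by_contra hno
  push Not at hno
  set n : ℝ := (Fintype.card V : ℝ) with hn
  have hn0 : 0 < n := by
    have : Nonempty V := ⟨x⟩
    exact Nat.cast_pos.2 Fintype.card_pos
  have hU2 : (U'.card : ℝ) ≤ ε * n :=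
    le_trans (by exact_mod_cast (by omega : U'.card ≤ 2 * D)) hD
  have hcov : A ∪ (A ∪ U')ᶜ ∪ U' = Finset.univ := by
    ext v; simp only [Finset.mem_union, Finset.mem_compl, Finset.mem_univ, iff_true]; tauto
  obtain ⟨h1, h2⟩ := pairs_separated_upper (B := (A ∪ U')ᶜ) (U := U') ha hγ hε hγε hG
    (Finset.disjoint_left.2 fun v hv hv' =>
      Finset.mem_compl.1 hv' (Finset.mem_union_left _ hv)) hcov hU2 ⟨x, hxA⟩
    ⟨y, by simp [hyA, hyU']⟩ fun v hv w hw => by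
      rw [Finset.mem_compl, Finset.mem_union, not_or] at hw
      have := codeg_lt_of_not_adj (x := v) (y := w) (fun h => hw.1 (h ▸ hv)) (hno v hv w hw.1 hw.2)
      exact le_trans (by exact_mod_cast this.le) hD'
  have hε0 : 0 ≤ ε := by
    have : (0 : ℝ) ≤ ε * n := le_trans (Nat.cast_nonneg _) hU2
    exact le_of_mul_le_mul_right (by simpa using this) hn0
  have hn2 : 0 < n ^ 2 := by positivity
  have hlt := mul_lt_mul_of_pos_right hc hn2
  have hεn : 0 ≤ ε * n ^ 2 := by positivity
  rcases hX A with h | h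
  · nlinarith
  -- The complement of `A` is `B` together with the separator, which costs the additional `2ε` in
  -- `hc`.
  · have hsub : Aᶜ ⊆ (A ∪ U')ᶜ ∪ U' := by
      intro v
      simp only [Finset.mem_union, Finset.mem_compl]; tauto
    have e1 := pairs_mono (G := G) hsub (Finset.Subset.refl Aᶜ)
    have e2 := pairs_union_left_le (G := G) (A ∪ U')ᶜ U' Aᶜ
    have e3 := pairs_mono (G := G) (Finset.Subset.refl (A ∪ U')ᶜ) hsub
    have e4 := pairs_union_right_le (G := G) (A ∪ U')ᶜ (A ∪ U')ᶜ U'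
    have e5 := pairs_le_card_mul (G := G) U' Aᶜ
    have e6 := pairs_le_card_mul (G := G) (A ∪ U')ᶜ U'
    have c1 : ((Aᶜ).card : ℝ) ≤ n := by rw [hn]; exact_mod_cast Finset.card_le_univ _
    have c2 : (((A ∪ U')ᶜ).card : ℝ) ≤ n := by rw [hn]; exact_mod_cast Finset.card_le_univ _
    have f1 : (U'.card : ℝ) * (Aᶜ).card ≤ ε * n * n :=
      mul_le_mul hU2 c1 (Nat.cast_nonneg _) (by positivity)
    have f2 : (((A ∪ U')ᶜ).card : ℝ) * U'.card ≤ n * (ε * n) :=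
      mul_le_mul c2 hU2 (Nat.cast_nonneg _) hn0.le
    nlinarith

/-- Codegrees across the bipartition vanish, so all vertices off `X`, apart from the separator, may
be put into `B`. The separation lemma then makes `B` sparse; but `B ∩ X` is large and its vertices
have all their neighbours in `B ∪ U'`, which gives about `a³ n² / 4` pairs inside `B`. -/
theorem Expands.codeg_linked_of_bipartite {a γ ε : ℝ} {D D' K : ℕ} (ha : 0 < a) (hγ : 0 < γ)
    (hε : ε ≤ a / 2) (hγε : γ + ε ≤ a ^ 2 / 2)
    (hc : (4 * γ / a + ε) / (a * (a ^ 2 / 2)) + 4 * γ / a < a ^ 3 / 4) (hG : Expands G a)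
    {X : Finset V} (hX : ∀ v w, G.Adj v w → (v ∈ X ↔ w ∉ X))
    (hD : (2 * D : ℝ) ≤ ε * Fintype.card V) (hD' : (D' : ℝ) ≤ γ * Fintype.card V)
    (hK : Fintype.card V < K * (D + 1)) (U : Finset V) (x y : V) (hU : U.card ≤ D) (hx : x ∉ U)
    (hy : y ∉ U) (hxX : x ∈ X) (hyX : y ∈ X) :
    ∃ p : (codegGraph G D').Walk x y, p.IsPath ∧ p.length ≤ K ∧ ∀ v ∈ p.support, v ∉ U := by
  refine exists_short_walk _ hK U x y hx hy fun A₀ U' hU' hxA₀ hyA₀ hyU' hAU₀ => ?_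
  by_contra hno
  push Not at hno
  set n : ℝ := (Fintype.card V : ℝ) with hn
  have hn0 : 0 < n := by
    have : Nonempty V := ⟨x⟩
    exact Nat.cast_pos.2 Fintype.card_pos
  have hU2 : (U'.card : ℝ) ≤ ε * n :=
    le_trans (by exact_mod_cast (by omega : U'.card ≤ 2 * D)) hD
  have hcross : ∀ v w, v ∈ X → w ∉ X → codeg G v w = 0 := by
    intro v w hv hw
    unfold codeg
    rw [Finset.card_eq_zero, Finset.filter_eq_empty_iff]
    rintro u - ⟨h1, h2⟩
    have := hX v u h1
    have := hX w u h2
    tauto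
  set A := A₀ ∩ X with hA
  set B := (A ∪ U')ᶜ with hB
  have hmemB : ∀ w, w ∈ B → w ∉ A ∧ w ∉ U' := fun w hw => by
    rwa [hB, Finset.mem_compl, Finset.mem_union, not_or] at hw
  have hcd : ∀ v ∈ A, ∀ w ∈ B, (codeg G v w : ℝ) ≤ γ * n := by
    intro v hv w hw
    have hvA := Finset.mem_inter.1 hv
    obtain ⟨hwA, hwU⟩ := hmemB w hw
    by_cases hwX : w ∈ X
    · have hwA₀ : w ∉ A₀ := fun h => hwA (Finset.mem_inter.2 ⟨h, hwX⟩)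
      have := codeg_lt_of_not_adj (x := v) (y := w) (fun h => hwA₀ (h ▸ hvA.1)) (hno v hvA.1 w hwA₀ hwU)
      exact le_trans (by exact_mod_cast this.le) hD'
    · rw [hcross v w hvA.2 hwX]
      simp only [Nat.cast_zero]; positivity
  have hcov : A ∪ B ∪ U' = Finset.univ := by
    ext v; simp only [hB, Finset.mem_union, Finset.mem_compl, Finset.mem_univ, iff_true]; tauto
  have hyA : y ∉ A := fun h => hyA₀ (Finset.mem_inter.1 h).1
  have hyB : y ∈ B := by simp [hB, hyA, hyU']
  obtain ⟨-, h2⟩ := pairs_separated_upper (A := A) (B := B) (U := U') ha hγ hε hγε hG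
    (Finset.disjoint_left.2 fun v hv hv' => (hmemB v hv').1 hv) hcov hU2
    ⟨x, Finset.mem_inter.2 ⟨hxA₀, hxX⟩⟩ ⟨y, hyB⟩ hcd
  have hcB : (a ^ 2 - γ - ε) * n ≤ (B ∩ X).card := by
    refine card_side_lower (A := B ∩ X) (B := A ∪ Xᶜ) (U := U') (x := y) ha.le hG ?_ hU2 hγ.le ?_
    · ext v
      simp only [hB, Finset.mem_union, Finset.mem_inter, Finset.mem_compl, Finset.mem_univ,
        iff_true]
      tauto
    · intro w hw
      rcases Finset.mem_union.1 hw with hw | hw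
      · have := hcd w hw y hyB
        simp only [codeg] at this ⊢
        simpa only [and_comm] using this
      · rw [hcross y w hyX (Finset.mem_compl.1 hw)]
        simp only [Nat.cast_zero]; positivity
  have hlow : ∀ v ∈ B ∩ X, a / 2 * n ≤ nbrs G B v := by
    intro v hv
    have hvX := (Finset.mem_inter.1 hv).2
    have e1 := hG.deg v
    have e2 : nbrs G Finset.univ v ≤ nbrs G (B ∪ U') v := by
      unfold nbrs
      rw [← Finset.sum_add_sum_compl (B ∪ U'), add_le_iff_nonpos_right]
      refine (Finset.sum_eq_zero fun w hw => ?_).le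
      have hwA : w ∈ A := by
        have := Finset.mem_univ w
        rw [← hcov] at this
        simp only [Finset.mem_union, Finset.mem_compl, not_or] at this hw
        tauto
      have : ¬ G.Adj v w := fun h => (hX v w h).1 hvX (Finset.mem_inter.1 hwA).2
      simp [adjInd, this]
    have e3 := nbrs_union_le (G := G) B U' v
    have e4 := nbrs_le_card (G := G) U' v
    nlinarith
  have hlow2 : (B ∩ X).card * (a / 2 * n) ≤ pairs G B B := by
    refine le_trans ?_ (pairs_mono (G := G) (Finset.inter_subset_left (s₂ := X))
      (Finset.Subset.refl B))
    unfold pairs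
    rw [← nsmul_eq_mul]
    exact Finset.card_nsmul_le_sum _ _ _ hlow
  have h3 : a ^ 2 / 2 * n * (a / 2 * n) ≤ (B ∩ X).card * (a / 2 * n) := by
    refine mul_le_mul_of_nonneg_right (le_trans ?_ hcB) (by positivity)
    exact mul_le_mul_of_nonneg_right (by linarith) hn0.le
  have hlt := mul_lt_mul_of_pos_right hc (by positivity : 0 < n ^ 2)
  nlinarith

/-- The triples with `x = y` allowed number Σ_r codeg(w, r)², at least `a⁴ n³` by Cauchy–Schwarz.
Those with `x = y` are at most `n²`, those meeting `U` at most `3 |U| n²`. -/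
theorem card_cherries {a : ℝ} (ha : 0 < a) (hG : Expands G a) (U : Finset V) (w : V) :
    a ^ 4 * (Fintype.card V : ℝ) ^ 3 - (1 + 3 * U.card) * (Fintype.card V : ℝ) ^ 2 ≤
      (cherries G U w).card := by
  have hn0 : (0 : ℝ) < Fintype.card V := by
    have : Nonempty V := ⟨w⟩
    exact Nat.cast_pos.2 Fintype.card_pos
  set T : Finset (V × V × V) := Finset.univ.filter fun τ =>
    (G.Adj w τ.1 ∧ G.Adj w τ.2.2) ∧ (G.Adj τ.1 τ.2.1 ∧ G.Adj τ.2.1 τ.2.2) with hT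
  have hTcard : a ^ 4 * (Fintype.card V : ℝ) ^ 3 ≤ T.card := by
    have e1 : (T.card : ℝ) = ∑ r, (codeg G w r : ℝ) ^ 2 := by
      rw [hT, Finset.card_filter]
      push_cast
      rw [Fintype.sum_prod_type]
      simp only [Fintype.sum_prod_type]
      rw [Finset.sum_comm]
      refine Finset.sum_congr rfl fun r _ => ?_
      rw [codeg_eq_sum, sq, Finset.sum_mul_sum]
      refine Finset.sum_congr rfl fun x _ => Finset.sum_congr rfl fun y _ => ?_
      simp only [adjInd, G.adj_comm x r]
      by_cases h1 : G.Adj w x <;> by_cases h2 : G.Adj w y <;> by_cases h3 : G.Adj r x <;>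
        by_cases h4 : G.Adj r y <;> simp [h1, h2, h3, h4]
    have e2 := sum_codeg ha.le hG w
    have e3 := sq_sum_le_card_mul_sum_sq (s := (Finset.univ : Finset V))
      (f := fun r => (codeg G w r : ℝ))
    rw [Finset.card_univ, ← e1] at e3
    have e4 : (a ^ 2 * (Fintype.card V : ℝ) ^ 2) ^ 2 ≤ (∑ r, (codeg G w r : ℝ)) ^ 2 :=
      pow_le_pow_left₀ (by positivity) e2 2
    refine le_of_mul_le_mul_left (le_trans (le_of_eq ?_) (e4.trans e3)) hn0
    ring
  set B₀ : Finset (V × V × V) := (Finset.univ : Finset (V × V)).image fun q => (q.1, q.2, q.1)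
  set B₁ : Finset (V × V × V) := U ×ˢ (Finset.univ ×ˢ Finset.univ)
  set B₂ : Finset (V × V × V) := Finset.univ ×ˢ (U ×ˢ Finset.univ)
  set B₃ : Finset (V × V × V) := Finset.univ ×ˢ (Finset.univ ×ˢ U)
  have hsub : T ⊆ cherries G U w ∪ (B₀ ∪ (B₁ ∪ (B₂ ∪ B₃))) := by
    rintro ⟨x, r, y⟩ hτ
    obtain ⟨⟨h1, h2⟩, h3, h4⟩ := (Finset.mem_filter.1 hτ).2
    simp only [B₀, B₁, B₂, B₃, Finset.mem_union, Finset.mem_product, Finset.mem_univ, and_true,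
      true_and, Finset.mem_image, Prod.mk.injEq]
    by_cases hxU : x ∈ U
    · tauto
    by_cases hrU : r ∈ U
    · tauto
    by_cases hyU : y ∈ U
    · tauto
    by_cases hxy : x = y
    · exact Or.inr (Or.inl ⟨(x, r), rfl, rfl, hxy⟩)
    refine Or.inl (Finset.mem_filter.2 ⟨Finset.mem_univ _, ?_, ?_, h1, h2, h3, h4⟩)
    · have := h3.ne
      have := h4.ne
      simp only [List.nodup_cons, List.mem_cons, List.not_mem_nil, or_false, not_or,
        not_false_eq_true, List.nodup_nil, and_true]
      tauto
    · intro v hv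
      simp only [List.mem_cons, List.not_mem_nil, or_false] at hv
      rcases hv with rfl | rfl | rfl <;> assumption
  have hc := Finset.card_le_card hsub
  have c0 : B₀.card ≤ Fintype.card V ^ 2 := by
    refine Finset.card_image_le.trans ?_
    rw [Finset.card_univ, Fintype.card_prod, sq]
  have c1 : B₁.card = U.card * Fintype.card V ^ 2 := by
    simp only [B₁, Finset.card_product, Finset.card_univ]; ring
  have c2 : B₂.card = U.card * Fintype.card V ^ 2 := by
    simp only [B₂, Finset.card_product, Finset.card_univ]; ring
  have c3 : B₃.card = U.card * Fintype.card V ^ 2 := by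
    simp only [B₃, Finset.card_product, Finset.card_univ]; ring
  have d1 := Finset.card_union_le (cherries G U w) (B₀ ∪ (B₁ ∪ (B₂ ∪ B₃)))
  have d2 := Finset.card_union_le B₀ (B₁ ∪ (B₂ ∪ B₃))
  have d3 := Finset.card_union_le B₁ (B₂ ∪ B₃)
  have d4 := Finset.card_union_le B₂ B₃
  have hfin : T.card ≤ (cherries G U w).card + (1 + 3 * U.card) * Fintype.card V ^ 2 := by
    nlinarith
  have hfin' : (T.card : ℝ) ≤ (cherries G U w).card +
      (1 + 3 * U.card) * (Fintype.card V : ℝ) ^ 2 := by exact_mod_cast hfin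
  linarith

end Linking

end RobustAbsorb

namespace RobustAbsorb

/-! ### From robust graphs to expansion, and the maximum cut -/

section Robust

open Classical

variable {V : Type*} {G : SimpleGraph V}

theorem edgesBetween_eq_pairs (X Y : Finset V) : (edgesBetween G X Y : ℝ) = pairs G X Y := by
  unfold edgesBetween pairs nbrs adjInd
  rw [SimpleGraph.interedges_def, Finset.card_filter]
  push_cast
  rw [Finset.sum_product]

theorem pairs_insert_self {S : Finset V} {v : V} (hv : v ∉ S) :
    pairs G (insert v S) (insert v S) = pairs G S S + 2 * nbrs G S v := by
  have h0 : adjInd G v v = 0 := by simp [adjInd]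
  have h1 : ∀ w, nbrs G (insert v S) w = adjInd G w v + nbrs G S w := fun w => by
    unfold nbrs; rw [Finset.sum_insert hv]
  unfold pairs
  rw [Finset.sum_insert hv, h1, h0]
  simp only [h1, Finset.sum_add_distrib]
  have h2 : ∑ w ∈ S, adjInd G w v = nbrs G S v :=
    Finset.sum_congr rfl fun w _ => adjInd_comm _ _
  rw [h2]
  ring

variable [Fintype V]

theorem degree_eq_nbrs (v : V) [Fintype (G.neighborSet v)] :
    (G.degree v : ℝ) = nbrs G Finset.univ v := by
  have h : G.neighborFinset v = Finset.univ.filter (G.Adj v) := by ext w; simp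
  unfold nbrs adjInd
  rw [← SimpleGraph.card_neighborFinset_eq_degree, h, Finset.card_filter]
  push_cast
  rfl

theorem nbrs_add_nbrs_compl (X : Finset V) (v : V) :
    nbrs G X v + nbrs G Xᶜ v = nbrs G Finset.univ v :=
  Finset.sum_add_sum_compl X _

theorem IsRobust.deg {η α : ℝ} (h : IsRobust G η α) (v : V) :
    η * Fintype.card V ≤ nbrs G Finset.univ v := by
  rw [← degree_eq_nbrs]
  exact h.1.trans (by exact_mod_cast G.minDegree_le_degree v)

theorem IsRobust.cut {η α : ℝ} (h : IsRobust G η α) (X : Finset V) :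
    α * X.card * (Xᶜ).card ≤ pairs G X Xᶜ := by
  have := h.2
  unfold HasSparseCut at this
  push Not at this
  rw [← edgesBetween_eq_pairs]
  exact this X

theorem isRobust_of [Nonempty V] {η α : ℝ}
    (hd : ∀ v, η * Fintype.card V ≤ nbrs G Finset.univ v)
    (hc : ∀ X : Finset V, α * X.card * (Xᶜ).card ≤ pairs G X Xᶜ) : IsRobust G η α := by
  refine ⟨?_, ?_⟩
  · obtain ⟨v, hv⟩ := G.exists_minimal_degree_vertex
    rw [hv, degree_eq_nbrs]
    exact hd v
  · unfold HasSparseCut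
    push Not
    intro X
    rw [edgesBetween_eq_pairs]
    exact hc X

theorem IsRobust.expands {η α a : ℝ} (h : IsRobust G η α) (h1 : a ≤ η) (h2 : a ≤ α) :
    Expands G a where
  deg v := (mul_le_mul_of_nonneg_right h1 (Nat.cast_nonneg _)).trans (h.deg v)
  cut X := le_trans (by gcongr) (h.cut X)

theorem pairs_self (X : Finset V) : pairs G X X = 2 * (edgesInside G X : ℝ) := by
  -- Handshaking in the graph of the edges inside `X`: `pairs` counts ordered pairs.
  set G' : SimpleGraph V :=
    { Adj := fun v w => G.Adj v w ∧ v ∈ X ∧ w ∈ X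
      symm := ⟨fun v w h => ⟨h.1.symm, h.2.2, h.2.1⟩⟩
      loopless := ⟨fun v h => G.loopless.irrefl v h.1⟩ } with hG'
  have h1 := G'.sum_degrees_eq_twice_card_edges
  have h2 : G'.edgeFinset.card = edgesInside G X := by
    unfold edgesInside
    congr 1
    ext e
    induction e with
    | h v w =>
      simp [hG']
  rw [h2] at h1
  have h3 : ((∑ v, G'.degree v : ℕ) : ℝ) = 2 * (edgesInside G X : ℝ) := by exact_mod_cast h1
  rw [← h3]
  push_cast
  simp only [degree_eq_nbrs]
  unfold pairs
  rw [← Finset.sum_subset (Finset.subset_univ X)]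
  · refine Finset.sum_congr rfl fun v hv => ?_
    unfold nbrs
    rw [← Finset.sum_subset (Finset.subset_univ X)]
    · refine Finset.sum_congr rfl fun w hw => ?_
      simp [adjInd, hG', hv, hw]
    · intro w _ hw
      simp [adjInd, hG', hw]
  · intro v _ hv
    unfold nbrs
    exact Finset.sum_eq_zero fun w _ => by simp [adjInd, hG', hv]

/-- Moving `v` to the other side changes the inside count by twice the difference of the two
degrees. -/
theorem nbrs_le_of_max_cut {X : Finset V}
    (hX : ∀ Y : Finset V, pairs G X X + pairs G Xᶜ Xᶜ ≤ pairs G Y Y + pairs G Yᶜ Yᶜ) {v : V}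
    (hv : v ∈ X) : nbrs G X v ≤ nbrs G Xᶜ v := by
  have h1 := hX (X.erase v)
  have h2 : (X.erase v)ᶜ = insert v Xᶜ := Finset.compl_erase
  have h3 := pairs_insert_self (G := G) (Finset.notMem_erase v X)
  rw [Finset.insert_erase hv] at h3
  have h4 := pairs_insert_self (G := G) (S := Xᶜ) (v := v) (by simpa using hv)
  rw [h2, h4, h3] at h1
  have h5 : nbrs G X v = nbrs G (X.erase v) v := by
    unfold nbrs
    rw [← Finset.add_sum_erase _ _ hv]
    simp [adjInd]
  rw [h5]
  linarith

/-- A maximum cut keeps half of every degree and loses at most `4α⁴n²` ordered pairs. For a balanced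
cut `|U||Uᶜ| ≥ 8α³n²`, that loss is at most half of `α|U||Uᶜ|`. Otherwise the smaller side has at
most `16α³n` vertices, and the minimum degree alone gives enough edges out of it. -/
theorem exists_robust_cut [Nonempty V] {η α : ℝ} (hα : 0 < α) (hα4 : α ≤ 1 / 4) (hη : 4 * α ≤ η)
    (hG : IsRobust G η α) (hnb : IsNearBipartite G (α ^ 4)) :
    ∃ X : Finset V, IsRobust (G.between (X : Set V) ((Xᶜ : Finset V) : Set V)) (η / 2) (α / 2) := by
  set n : ℝ := (Fintype.card V : ℝ) with hn
  have hn0 : 0 < n := Nat.cast_pos.2 Fintype.card_pos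
  obtain ⟨X, -, hX⟩ := Finset.exists_min_image (Finset.univ : Finset (Finset V))
    (fun X => pairs G X X + pairs G Xᶜ Xᶜ) Finset.univ_nonempty
  have hX' : ∀ Y : Finset V, pairs G X X + pairs G Xᶜ Xᶜ ≤ pairs G Y Y + pairs G Yᶜ Yᶜ :=
    fun Y => hX Y (Finset.mem_univ Y)
  have hXsmall : pairs G X X + pairs G Xᶜ Xᶜ ≤ 4 * α ^ 4 * n ^ 2 := by
    obtain ⟨Y, h1, h2⟩ := hnb
    have := hX' Y
    rw [pairs_self Y, pairs_self Yᶜ] at this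
    linarith
  have hXc : ∀ Y : Finset V,
      pairs G Xᶜ Xᶜ + pairs G Xᶜᶜ Xᶜᶜ ≤ pairs G Y Y + pairs G Yᶜ Yᶜ := fun Y => by
    rw [compl_compl, add_comm]; exact hX' Y
  refine ⟨X, ?_⟩
  set H := G.between (X : Set V) ((Xᶜ : Finset V) : Set V) with hH
  have hadj1 : ∀ v ∈ X, ∀ w, adjInd H v w = if w ∈ X then 0 else adjInd G v w := by
    intro v hv w
    by_cases hw : w ∈ X <;> simp [adjInd, hH, SimpleGraph.between_adj, hv, hw]
  have hadj2 : ∀ v, v ∉ X → ∀ w, adjInd H v w = if w ∈ X then adjInd G v w else 0 := by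
    intro v hv w
    by_cases hw : w ∈ X <;> simp [adjInd, hH, SimpleGraph.between_adj, hv, hw]
  have hdeg : ∀ v, η / 2 * n ≤ nbrs H Finset.univ v := by
    intro v
    have h1 := hG.deg v
    rw [← nbrs_add_nbrs_compl X] at h1
    rw [← nbrs_add_nbrs_compl X]
    by_cases hv : v ∈ X
    · have h2 := nbrs_le_of_max_cut hX' hv
      have h3 : nbrs H Xᶜ v = nbrs G Xᶜ v := Finset.sum_congr rfl fun w hw => by
        rw [hadj1 v hv, if_neg (Finset.mem_compl.1 hw)]
      have h4 := nbrs_nonneg (G := H) X v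
      linarith
    · have h2 := nbrs_le_of_max_cut hXc (Finset.mem_compl.2 hv)
      rw [compl_compl] at h2
      have h3 : nbrs H X v = nbrs G X v := Finset.sum_congr rfl fun w hw => by
        rw [hadj2 v hv, if_pos hw]
      have h4 := nbrs_nonneg (G := H) Xᶜ v
      linarith
  have hsmall : ∀ S : Finset V, (S.card : ℝ) ≤ 16 * α ^ 3 * n →
      α / 2 * S.card * (Sᶜ).card ≤ pairs H S Sᶜ := by
    intro S hS
    have h1 : (Sᶜ.card : ℝ) ≤ n := by rw [hn]; exact_mod_cast Finset.card_le_univ _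
    have h2 : ∀ v ∈ S, α / 2 * n ≤ nbrs H Sᶜ v := by
      intro v _
      have h3 := hdeg v
      rw [← nbrs_add_nbrs_compl S] at h3
      have h4 := nbrs_le_card (G := H) S v
      have h5 : 16 * α ^ 3 ≤ α := by
        have : α ^ 2 ≤ (1 / 4) ^ 2 := pow_le_pow_left₀ hα.le hα4 2
        nlinarith
      have h6 : 16 * α ^ 3 * n ≤ α * n := mul_le_mul_of_nonneg_right h5 hn0.le
      have h7 : 4 * α * n ≤ η * n := mul_le_mul_of_nonneg_right hη hn0.le
      have h8 : 0 ≤ α * n := by positivity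
      linarith
    have h3 : (S.card : ℝ) * (α / 2 * n) ≤ pairs H S Sᶜ := by
      unfold pairs
      rw [← nsmul_eq_mul]
      exact Finset.card_nsmul_le_sum _ _ _ h2
    refine le_trans ?_ h3
    have h4 : α / 2 * S.card * (Sᶜ).card ≤ α / 2 * S.card * n :=
      mul_le_mul_of_nonneg_left h1 (by positivity)
    linarith
  refine isRobust_of hdeg fun U => ?_
  have hUsum : (U.card : ℝ) + (Uᶜ).card = n := by
    rw [hn]; exact_mod_cast Finset.card_add_card_compl U
  by_cases hbig : 8 * α ^ 3 * n ^ 2 ≤ U.card * (Uᶜ).card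
  · have h1 := hG.cut U
    have h2 : pairs G U Uᶜ ≤ pairs H U Uᶜ + (pairs G X X + pairs G Xᶜ Xᶜ) := by
      have e1 : ∀ v, nbrs G Uᶜ v ≤
          nbrs H Uᶜ v + if v ∈ X then nbrs G X v else nbrs G Xᶜ v := by
        intro v
        split_ifs with hv
        · have : nbrs G Uᶜ v ≤ nbrs H Uᶜ v + nbrs G (Uᶜ ∩ X) v := by
            unfold nbrs
            rw [← Finset.sum_inter_add_sum_sdiff Uᶜ X,
              ← Finset.sum_inter_add_sum_sdiff Uᶜ X (adjInd H v)]
            have e : ∑ w ∈ Uᶜ \ X, adjInd H v w = ∑ w ∈ Uᶜ \ X, adjInd G v w :=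
              Finset.sum_congr rfl fun w hw => by
                rw [hadj1 v hv, if_neg (Finset.mem_sdiff.1 hw).2]
            have e' : 0 ≤ ∑ w ∈ Uᶜ ∩ X, adjInd H v w :=
              Finset.sum_nonneg fun _ _ => adjInd_nonneg _ _
            linarith
          exact this.trans (by
            have := nbrs_mono (G := G) (Finset.inter_subset_right (s₁ := Uᶜ) (s₂ := X)) v
            linarith)
        · have : nbrs G Uᶜ v ≤ nbrs H Uᶜ v + nbrs G (Uᶜ \ X) v := by
            unfold nbrs
            rw [← Finset.sum_inter_add_sum_sdiff Uᶜ X,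
              ← Finset.sum_inter_add_sum_sdiff Uᶜ X (adjInd H v)]
            have e : ∑ w ∈ Uᶜ ∩ X, adjInd H v w = ∑ w ∈ Uᶜ ∩ X, adjInd G v w :=
              Finset.sum_congr rfl fun w hw => by
                rw [hadj2 v hv, if_pos (Finset.mem_inter.1 hw).2]
            have e' : 0 ≤ ∑ w ∈ Uᶜ \ X, adjInd H v w :=
              Finset.sum_nonneg fun _ _ => adjInd_nonneg _ _
            linarith
          have hs : Uᶜ \ X ⊆ Xᶜ := fun w hw => Finset.mem_compl.2 (Finset.mem_sdiff.1 hw).2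
          exact this.trans (by
            have := nbrs_mono (G := G) hs v
            linarith)
      have e2 : ∑ v ∈ U, (if v ∈ X then nbrs G X v else nbrs G Xᶜ v) ≤
          pairs G X X + pairs G Xᶜ Xᶜ := by
        have e3 : ∑ v ∈ U, (if v ∈ X then nbrs G X v else nbrs G Xᶜ v) ≤
            ∑ v, (if v ∈ X then nbrs G X v else nbrs G Xᶜ v) :=
          Finset.sum_le_sum_of_subset_of_nonneg (Finset.subset_univ U) fun v _ _ => by
            split_ifs <;> exact nbrs_nonneg _ _
        refine e3.trans (le_of_eq ?_)
        rw [← Finset.sum_add_sum_compl X]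
        unfold pairs
        congr 1
        · exact Finset.sum_congr rfl fun v hv => if_pos hv
        · exact Finset.sum_congr rfl fun v hv => if_neg (Finset.mem_compl.1 hv)
      have e4 := Finset.sum_le_sum fun v (_ : v ∈ U) => e1 v
      rw [Finset.sum_add_distrib] at e4
      unfold pairs at e2 ⊢
      linarith
    have h3 := mul_le_mul_of_nonneg_left hbig (by positivity : 0 ≤ α / 2)
    nlinarith
  · push Not at hbig
    rcases le_total (U.card : ℝ) ((Uᶜ).card : ℝ) with h | h
    · refine hsmall U ?_
      have h1 : (U.card : ℝ) * (n / 2) ≤ U.card * (Uᶜ).card :=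
        mul_le_mul_of_nonneg_left (by linarith) (Nat.cast_nonneg _)
      refine le_of_mul_le_mul_right ?_ (by positivity : 0 < n / 2)
      nlinarith
    · have h1 : (Uᶜ.card : ℝ) * (n / 2) ≤ (Uᶜ).card * U.card :=
        mul_le_mul_of_nonneg_left (by linarith) (Nat.cast_nonneg _)
      have h2 := hsmall Uᶜ (by
        refine le_of_mul_le_mul_right ?_ (by positivity : 0 < n / 2)
        nlinarith)
      rw [compl_compl, pairs_comm] at h2
      linarith

end Robust

end RobustAbsorb

namespace RobustAbsorb

/-! ### Assembling the absorbing path in the two cases -/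

section Main

open Classical

variable {V : Type*} [Fintype V] {G : SimpleGraph V}

theorem exists_family_hits [Nonempty V] {D D' K t m : ℕ} {β : ℝ} {Adm : V → V → Prop}
    (hβ : 0 < β)
    (hT : ∀ (U : Finset V) (r r' z : V), Adm r r' → G.Adj r' z → U.card ≤ D → r ∉ U → z ∉ U →
      ∃ p : (codegGraph G D').Walk r z, p.IsPath ∧ p.length ≤ K ∧ ∀ v ∈ p.support, v ∉ U)
    (hAdm : ∀ w w' x r x' r', Adm w w' → G.Adj w x → G.Adj x r → G.Adj w' x' → G.Adj x' r' →
      Adm r r')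
    (hcount : ∀ (U : Finset V) (w : V), U.card ≤ D →
      β * (Fintype.card V : ℝ) ^ 3 ≤ (cherries G U w).card)
    {C₀ : List (List V)} (hC₀ : IsPathSystem G ∅ C₀)
    (hD : C₀.flatten.length + t * (3 * K + 8) + 7 ≤ D) (hD' : D + 3 * K + 12 ≤ D')
    (hm : (Fintype.card V : ℝ) ^ 2 * (1 - β ^ 2 / 2) ^ t < (1 / 2) ^ m)
    (hβ1 : 0 ≤ 1 - β ^ 2 / 2) :
    ∃ F : List (List (List V)), IsPathSystem G ∅ (C₀ ++ F.flatten) ∧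
      F.flatten.flatten.length ≤ t * (3 * K + 8) ∧
      ∀ w w', Adm w w' → m ≤ hits G F (w, w') := by
  set U₀ := C₀.flatten.toFinset with hU₀
  have hU₀c : U₀.card ≤ C₀.flatten.length := C₀.flatten.toFinset_card_le
  set P : Finset (V × V) := Finset.univ.filter fun w => Adm w.1 w.2 with hP
  obtain ⟨F, hF, hFl, hsum⟩ := exists_absorbing_family (G := G) P
    (Fits G) U₀ (s := 3 * K + 8) (N := t * (3 * K + 8))
    (pow_pos hβ 2) (fun U hU w hw => by
      have hUU := Finset.card_union_le U₀ U
      refine (many_pair_absorbers hβ hT hAdm hcount (U₀ ∪ U) (by omega) (by omega) w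
        (Finset.mem_filter.1 hw).2).trans ?_
      norm_cast
      refine Finset.card_le_card fun ω hω => ?_
      obtain ⟨h2, C, h3, h4, h5⟩ := (Finset.mem_filter.1 hω).2
      exact Finset.mem_filter.2
        ⟨Finset.mem_univ _, h2, C, h3, h4, fun w' _ hw' => h5 w' hw'⟩)
    t le_rfl
  refine ⟨F, hC₀.append (hF.mono (Finset.empty_subset _)) fun v hv hv' =>
    hF.avoid v hv' (List.mem_toFinset.2 hv), hFl, fun w w' hw => ?_⟩
  have hmem : (w, w') ∈ P := Finset.mem_filter.2 ⟨Finset.mem_univ _, hw⟩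
  have h1 : (1 / 2 : ℝ) ^ hits G F (w, w') ≤ ∑ w ∈ P, (1 / 2 : ℝ) ^ hits G F w :=
    Finset.single_le_sum (f := fun w => (1 / 2 : ℝ) ^ hits G F w)
      (fun _ _ => by positivity) hmem
  have hPc : (P.card : ℝ) ≤ (Fintype.card V : ℝ) ^ 2 := by
    have := Finset.card_le_univ P
    rw [Fintype.card_prod, ← sq] at this
    exact_mod_cast this
  have h2 : (1 / 2 : ℝ) ^ hits G F (w, w') < (1 / 2) ^ m :=
    (h1.trans hsum).trans_lt
      ((mul_le_mul_of_nonneg_right hPc (pow_nonneg hβ1 t)).trans_lt hm)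
  exact ((pow_lt_pow_iff_right_of_lt_one₀ (by norm_num) (by norm_num)).1 h2).le

/-- The inequalities between the parameters used in the construction of absorbing paths. -/
structure Params (a ρ : ℝ) (n K D D' t m : ℕ) : Prop where
  pos : 0 < n
  levels : n < K * (D + 1)
  D_le : (D : ℝ) ≤ a ^ 12 * n
  D'_le : (D' : ℝ) ≤ a ^ 10 * n
  gap : D + 3 * K + 12 ≤ D'
  cherry : 1 + 3 * (D : ℝ) ≤ a ^ 4 / 2 * n
  size : (((K + 1) * (2 * K + 1 + t * (3 * K + 8)) : ℕ) : ℝ) ≤ ρ * n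
  size' : (K + 1) * (2 * K + 1 + t * (3 * K + 8)) + 7 ≤ D
  hit : (n : ℝ) ^ 2 * (1 - (a ^ 4 / 2) ^ 2 / 2) ^ t < (1 / 2) ^ m
  m_ge : ρ ^ 3 * n + K ≤ m + 1

/-- With `γ = a^10` and `ε = 2a^12` the density of a separated side is of order `a^6`, well below
both `16a^4` (not near-bipartite) and `a^3/4` (bipartite). -/
theorem numeric_bound {a : ℝ} (ha : 0 < a) (ha' : a ≤ 1 / 128) :
    (4 * a ^ 10 / a + 2 * a ^ 12) / (a * (a ^ 2 / 2)) + 4 * a ^ 10 / a + 2 * (2 * a ^ 12) ≤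
      20 * a ^ 6 := by
  have e1 : (4 * a ^ 10 / a + 2 * a ^ 12) / (a * (a ^ 2 / 2)) + 4 * a ^ 10 / a +
      2 * (2 * a ^ 12) = a ^ 6 * (8 + 4 * a ^ 3 + 4 * a ^ 3 + 4 * a ^ 6) := by
    field_simp
    ring
  rw [e1]
  have h3 : a ^ 3 ≤ 1 := pow_le_one₀ ha.le (by linarith)
  have h6 : a ^ 6 ≤ 1 := pow_le_one₀ ha.le (by linarith)
  have h0 : 0 ≤ a ^ 6 := by positivity
  nlinarith

theorem scale_bounds {a : ℝ} (ha : 0 < a) (ha' : a ≤ 1 / 128) :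
    2 * a ^ 12 ≤ a / 2 ∧ a ^ 10 + 2 * a ^ 12 ≤ a ^ 2 / 2 ∧ 2 * a ^ 12 < a ^ 2 := by
  have h8 : a ^ 8 ≤ (1 / 128) ^ 8 := pow_le_pow_left₀ ha.le ha' 8
  have h10 : a ^ 10 ≤ (1 / 128) ^ 10 := pow_le_pow_left₀ ha.le ha' 10
  have h2 : 0 < a ^ 2 := by positivity
  have e1 : a ^ 10 = a ^ 2 * a ^ 8 := by ring
  have e2 : a ^ 12 = a ^ 2 * a ^ 10 := by ring
  have e3 : a ^ 2 ≤ a := by nlinarith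
  rw [e2]
  refine ⟨by nlinarith, by rw [e1] at h10 ⊢; nlinarith, by nlinarith⟩

theorem Params.shortlyLinked {a ρ : ℝ} {K D D' t m : ℕ}
    (hp : Params a ρ (Fintype.card V) K D D' t m) (ha : 0 < a) (ha' : a ≤ 1 / 128)
    (hG : Expands G a) : ShortlyLinked G D K := by
  have hn0 : (0 : ℝ) < Fintype.card V := Nat.cast_pos.2 hp.pos
  refine hG.shortlyLinked ha ?_ hp.levels
  refine lt_of_le_of_lt (mul_le_mul_of_nonneg_left hp.D_le (by norm_num)) ?_
  rw [← mul_assoc]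
  exact mul_lt_mul_of_pos_right (scale_bounds ha ha').2.2 hn0

theorem Params.card_cherries {a ρ : ℝ} {K D D' t m : ℕ}
    (hp : Params a ρ (Fintype.card V) K D D' t m) (ha : 0 < a) (hG : Expands G a)
    (U : Finset V) (w : V) (hU : U.card ≤ D) :
    a ^ 4 / 2 * (Fintype.card V : ℝ) ^ 3 ≤ (cherries G U w).card := by
  refine le_trans ?_ (RobustAbsorb.card_cherries ha hG U w)
  have h1 : (U.card : ℝ) ≤ D := by exact_mod_cast hU
  have h2 := hp.cherry
  have h3 : (1 + 3 * (U.card : ℝ)) * (Fintype.card V : ℝ) ^ 2 ≤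
      a ^ 4 / 2 * Fintype.card V * (Fintype.card V : ℝ) ^ 2 :=
    mul_le_mul_of_nonneg_right (by linarith) (by positivity)
  nlinarith

theorem exists_absorbing_path {a ρ : ℝ} {n K D D' t m : ℕ} (hn : Fintype.card V = n)
    (hp : Params a ρ n K D D' t m) (ha : 0 < a) (ha' : a ≤ 1 / 128) (hG : Expands G a)
    (hX : ∀ X : Finset V, 16 * a ^ 4 * (Fintype.card V : ℝ) ^ 2 ≤ pairs G X X ∨
      16 * a ^ 4 * (Fintype.card V : ℝ) ^ 2 ≤ pairs G Xᶜ Xᶜ) :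
    ∃ (u v : V) (p : G.Walk u v), p.IsPath ∧
      (p.support.length : ℝ) ≤ ρ * Fintype.card V ∧
      ∀ W : Finset V, (∀ w ∈ W, w ∉ p.support) → (W.card : ℝ) ≤ ρ ^ 3 * Fintype.card V →
        Absorbs G p W := by
  have hne : Nonempty V := Fintype.card_pos_iff.1 (hn ▸ hp.pos)
  have hn0 : (0 : ℝ) < n := Nat.cast_pos.2 hp.pos
  subst hn
  have hlink : ∀ (U : Finset V) (x y : V), U.card ≤ D → x ∉ U → y ∉ U →
      ∃ p : (codegGraph G D').Walk x y, p.IsPath ∧ p.length ≤ K ∧ ∀ v ∈ p.support, v ∉ U := by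
    obtain ⟨b1, b2, -⟩ := scale_bounds ha ha'
    refine fun U x y => hG.codeg_linked (γ := a ^ 10) (ε := 2 * a ^ 12) (c := 16 * a ^ 4) ha
      (by positivity) b1 b2 ?_ hX (by linarith [hp.D_le]) hp.D'_le hp.levels U x y
    refine lt_of_le_of_lt (numeric_bound ha ha') ?_
    have e : a ^ 6 = a ^ 4 * a ^ 2 := by ring
    have h2 : a ^ 2 ≤ (1 / 128) ^ 2 := pow_le_pow_left₀ ha.le ha' 2
    have h4 : 0 < a ^ 4 := by positivity
    rw [e]
    nlinarith
  have hsh := hp.shortlyLinked ha ha' hG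
  have hcount := hp.card_cherries ha hG
  obtain ⟨x⟩ := id hne
  obtain ⟨y, hxy⟩ : ∃ y, G.Adj x y := by
    by_contra hno
    push Not at hno
    have h1 := hG.deg x
    have h2 : nbrs G Finset.univ x = 0 := Finset.sum_eq_zero fun w _ => by simp [adjInd, hno w]
    rw [h2] at h1
    exact absurd h1 (not_le.2 (by positivity))
  have hpD := hp.size'
  have hgap := hp.gap
  obtain ⟨p, hpp, hpK, -⟩ := hlink ∅ x y (by simp) (by simp) (by simp)
  obtain ⟨l, l1, l2, l3, l4, -⟩ := exists_doubled_path p hpp ∅ (by simp) (by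
    rw [Finset.card_empty]; omega)
  have hp1 : 1 ≤ p.length := by
    by_contra h
    exact hxy.ne (SimpleGraph.Walk.eq_of_length_eq_zero (p := p) (by omega))
  have hl : l ≠ [] := by
    rintro rfl
    simp only [List.length_nil] at l4
    omega
  obtain ⟨mid, rfl⟩ : ∃ mid, l = mid ++ [y] := by
    refine ⟨l.dropLast, ?_⟩
    conv_lhs => rw [← List.dropLast_append_getLast hl]
    congr 2
    rw [List.getLast?_cons_of_ne_nil hl, List.getLast?_eq_some_getLast hl] at l3
    exact Option.some_inj.1 l3
  -- The parity switch: `S` has an odd number of vertices and adjacent ends, so replacing it by `[x,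
  -- y]` releases the odd number `2 * p.length - 1` of vertices in `mid`.
  set S : List V := x :: (mid ++ [y]) with hS
  have hSlen : S.length = 2 * p.length + 1 := by rw [hS, List.length_cons, l4]
  have hC₀ : IsPathSystem G ∅ [S] := ⟨by simp [hS], by simpa using l1, by simpa using l2, by simp⟩
  have hflat : [S].flatten = S := by simp
  have hK1 : 2 * K + 1 + t * (3 * K + 8) ≤ (K + 1) * (2 * K + 1 + t * (3 * K + 8)) :=
    Nat.le_mul_of_pos_left _ (by omega)
  obtain ⟨F, hF, hFl, hhits⟩ := exists_family_hits (m := m) (t := t) (D := D) (D' := D') (K := K)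
    (Adm := fun _ _ : V => True) (by positivity : 0 < a ^ 4 / 2)
    (fun U r r' z _ _ hU hr hz => hlink U r z hU hr hz) (fun _ _ _ _ _ _ _ _ _ _ _ => trivial)
    hcount hC₀ (by rw [hflat]; omega) hgap hp.hit (by
      have h4 : a ^ 4 ≤ 1 := pow_le_one₀ ha.le (by linarith)
      have : (a ^ 4 / 2) ^ 2 ≤ 1 := pow_le_one₀ (by positivity) (by linarith)
      linarith)
  have hlen : ([S] ++ F.flatten).flatten.length ≤ 2 * K + 1 + t * (3 * K + 8) := by
    rw [List.flatten_append, List.length_append, hflat]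
    omega
  have hlen' : (K + 1) * ([S] ++ F.flatten).flatten.length ≤
      (K + 1) * (2 * K + 1 + t * (3 * K + 8)) := Nat.mul_le_mul_left _ hlen
  obtain ⟨u, v, q, hq, hql, hqW⟩ := exists_path_of_system hsh (by simp) hF (by omega)
  refine ⟨u, v, q, hq, ?_, fun W hW hWc => hqW W hW ?_⟩
  · refine le_trans ?_ hp.size
    exact_mod_cast hql.trans hlen'
  have hWm : W.card + K ≤ m + 1 := by
    have := hp.m_ge
    exact_mod_cast (by linarith : (W.card : ℝ) + K ≤ m + 1)
  have hKp : p.length ≤ K := hpK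
  have hmidl : mid.length + 1 = 2 * p.length := by simpa using l4
  have hFc : ∀ C ∈ F.flatten, C.IsChain G.Adj := fun C hC => hF.chain C (by simp [hC])
  rcases Nat.even_or_odd' W.card with ⟨k, hk | hk⟩
  · obtain ⟨P, hPk, hP⟩ := exists_pairing k W.toList (by rw [Finset.length_toList, hk])
    have h1 := (Reroutes.self hC₀.chain).append
      (reroutes_of_hits P F hFc fun w _ => le_trans (by omega) (hhits w.1 w.2 trivial))
    convert h1 using 1
    rw [← hP, List.flatten_append, ← Multiset.coe_add, Finset.coe_toList, add_assoc]
  -- Now `W` and `mid` together are even in number; the up to `K` additional pairs are why `m`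
  -- exceeds `ρ³n` by about `K`.
  · obtain ⟨P, hPk, hP⟩ := exists_pairing (k + p.length) (W.toList ++ mid) (by
      rw [List.length_append, Finset.length_toList]; omega)
    have h0 : SameEnds G S [x, y] := by
      refine ⟨rfl, ?_, by simpa using hxy⟩
      rw [l3]; rfl
    have h1 := (Reroutes.nil.cons h0).append
      (reroutes_of_hits P F hFc fun w _ => le_trans (by omega) (hhits w.1 w.2 trivial))
    convert h1 using 1
    rw [← hP, List.flatten_append, hflat, hS]
    simp only [← Multiset.coe_add, ← Multiset.cons_coe, Finset.coe_toList,
      ← Multiset.singleton_add, Multiset.coe_nil]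
    abel

theorem exists_absorbing_path_of_bipartite {a ρ : ℝ} {n K D D' t m : ℕ}
    (hn : Fintype.card V = n) (hp : Params a ρ n K D D' t m) (ha : 0 < a) (ha' : a ≤ 1 / 128)
    (hK : 0 < K) (hG : Expands G a) {X : Finset V} (hX : ∀ v w, G.Adj v w → (v ∈ X ↔ w ∉ X)) :
    ∃ (u v : V) (p : G.Walk u v), p.IsPath ∧
      (p.support.length : ℝ) ≤ ρ * Fintype.card V ∧
      ∀ W : Finset V, (∀ w ∈ W, w ∉ p.support) → (W ∩ X).card = (W ∩ Xᶜ).card →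
        ((W ∩ X).card : ℝ) ≤ ρ ^ 3 * Fintype.card V → Absorbs G p W := by
  have hne : Nonempty V := Fintype.card_pos_iff.1 (hn ▸ hp.pos)
  subst hn
  have hlink : ∀ (U : Finset V) (x y : V), U.card ≤ D → x ∉ U → y ∉ U → x ∈ X → y ∈ X →
      ∃ p : (codegGraph G D').Walk x y, p.IsPath ∧ p.length ≤ K ∧ ∀ v ∈ p.support, v ∉ U := by
    obtain ⟨b1, b2, -⟩ := scale_bounds ha ha'
    refine fun U x y => hG.codeg_linked_of_bipartite (γ := a ^ 10) (ε := 2 * a ^ 12) ha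
      (by positivity) b1 b2 ?_ hX (by linarith [hp.D_le]) hp.D'_le hp.levels U x y
    · have h0 := numeric_bound ha ha'
      have e : a ^ 6 = a ^ 3 * a ^ 3 := by ring
      have h2 : a ^ 3 ≤ (1 / 128) ^ 3 := pow_le_pow_left₀ ha.le ha' 3
      have h4 : 0 < a ^ 3 := by positivity
      have h5 : 0 < a ^ 12 := by positivity
      rw [e] at h0
      nlinarith
  have hsh := hp.shortlyLinked ha ha' hG
  have hcount := hp.card_cherries ha hG
  obtain ⟨x⟩ := id hne
  have hpD := hp.size'
  have hgap := hp.gap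
  -- No parity switch is needed here; the one-vertex path only ensures that the system is nonempty.
  have hC₀ : IsPathSystem G ∅ [[x]] := ⟨by simp, by simp, by simp, by simp⟩
  have hK1 : 2 * K + 1 + t * (3 * K + 8) ≤ (K + 1) * (2 * K + 1 + t * (3 * K + 8)) :=
    Nat.le_mul_of_pos_left _ (by omega)
  obtain ⟨F, hF, hFl, hhits⟩ := exists_family_hits (m := m) (t := t) (D := D) (D' := D') (K := K)
    (Adm := fun w w' : V => w ∈ X ∧ w' ∉ X) (by positivity : 0 < a ^ 4 / 2)
    (fun U r r' z h hz hU hr hz' => hlink U r z hU hr hz' h.1 (by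
      have := hX r' z hz; tauto))
    (fun w w' x r x' r' h h1 h2 h3 h4 => by
      have := hX _ _ h1; have := hX _ _ h2; have := hX _ _ h3; have := hX _ _ h4; tauto)
    hcount hC₀ (by
      simp only [List.flatten_cons, List.flatten_nil, List.length_append, List.length_cons,
        List.length_nil]
      omega) hgap hp.hit (by
      have h4 : a ^ 4 ≤ 1 := pow_le_one₀ ha.le (by linarith)
      have : (a ^ 4 / 2) ^ 2 ≤ 1 := pow_le_one₀ (by positivity) (by linarith)
      linarith)
  have hlen : ([[x]] ++ F.flatten).flatten.length ≤ 2 * K + 1 + t * (3 * K + 8) := by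
    rw [List.flatten_append, List.length_append]
    simp only [List.flatten_cons, List.flatten_nil, List.length_append, List.length_cons,
      List.length_nil]
    omega
  have hlen' : (K + 1) * ([[x]] ++ F.flatten).flatten.length ≤
      (K + 1) * (2 * K + 1 + t * (3 * K + 8)) := Nat.mul_le_mul_left _ hlen
  obtain ⟨u, v, q, hq, hql, hqW⟩ := exists_path_of_system hsh (by simp) hF (by omega)
  refine ⟨u, v, q, hq, ?_, fun W hW hWX hWc => hqW W hW ?_⟩
  · refine le_trans ?_ hp.size
    exact_mod_cast hql.trans hlen'
  have hWm : (W ∩ X).card ≤ m := by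
    have := hp.m_ge
    have h : (W ∩ X).card + K ≤ m + 1 := by
      exact_mod_cast (by linarith : ((W ∩ X).card : ℝ) + K ≤ m + 1)
    omega
  have hFc : ∀ C ∈ F.flatten, C.IsChain G.Adj := fun C hC => hF.chain C (by simp [hC])
  have hll : (W ∩ X).toList.length = (W ∩ Xᶜ).toList.length := by
    rw [Finset.length_toList, Finset.length_toList, hWX]
  have h1 := (Reroutes.self hC₀.chain).append
    (reroutes_of_hits ((W ∩ X).toList.zip (W ∩ Xᶜ).toList) F hFc fun w hw => by
      have hw' := List.of_mem_zip (a := w.1) (b := w.2) hw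
      rw [Finset.mem_toList, Finset.mem_toList, Finset.mem_inter, Finset.mem_inter,
        Finset.mem_compl] at hw'
      refine le_trans ?_ (hhits w.1 w.2 ⟨hw'.1.2, hw'.2.2⟩)
      rw [List.length_zip, Finset.length_toList]
      exact (min_le_left _ _).trans hWm)
  convert h1 using 1
  rw [List.map_fst_zip hll.le, List.map_snd_zip hll.ge, Finset.coe_toList, Finset.coe_toList,
    List.flatten_append, ← Multiset.coe_add, add_assoc]
  congr 2
  have hdis : Disjoint (W ∩ X) (W ∩ Xᶜ) := Finset.disjoint_left.2 fun v hv hv' =>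
    Finset.mem_compl.1 (Finset.mem_inter.1 hv').2 (Finset.mem_inter.1 hv).2
  have hW' : (W ∩ X).disjUnion (W ∩ Xᶜ) hdis = W := by
    rw [Finset.disjUnion_eq_union, ← Finset.inter_union_distrib_left, Finset.union_compl,
      Finset.inter_univ]
  conv_lhs => rw [← hW']
  rfl

end Main

end RobustAbsorb

namespace RobustAbsorb

/-! ### Choice of the parameters -/

section Numerics

open Filter

theorem eventually_linear_le {b c d : ℝ} (h : b < c) :
    ∀ᶠ n : ℕ in atTop, b * n + d ≤ c * n := by
  have h1 : Tendsto (fun n : ℕ => (c - b) * (n : ℝ)) atTop atTop :=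
    tendsto_natCast_atTop_atTop.const_mul_atTop (sub_pos.2 h)
  filter_upwards [h1.eventually_ge_atTop d] with n hn
  linarith

theorem eventually_sq_mul_exp_lt {c : ℝ} (hc : 0 < c) {δ : ℝ} (hδ : 0 < δ) :
    ∀ᶠ n : ℕ in atTop, (n : ℝ) ^ 2 * Real.exp (-(c * n)) < δ := by
  have h1 : Tendsto (fun n : ℕ => c * (n : ℝ)) atTop atTop :=
    tendsto_natCast_atTop_atTop.const_mul_atTop hc
  have h2 := (Real.tendsto_pow_mul_exp_neg_atTop_nhds_zero 2).comp h1
  filter_upwards [h2.eventually_lt_const (mul_pos (pow_pos hc 2) hδ)] with n hn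
  simp only [Function.comp] at hn
  rw [mul_pow, mul_assoc] at hn
  exact lt_of_mul_lt_mul_left hn (by positivity)

/-- The choices are `K ≈ a^{-12}`, `D ≈ a^12 n`, `D' ≈ a^10 n`, `t ≈ ρ² n` and `m ≈ ρ³ n + K`. The
path then has order `K² ρ² n`, below `ρ n` since `ρ ≤ a^40`, while `t` greedy steps shrink the
potential by about `exp(-a^8 ρ² n / 8)`, which beats `n^{-2} 2^{-m}` because `ρ` is far below `a^8 /
8`. -/
theorem eventually_params {a ρ : ℝ} (ha : 0 < a) (ha' : a ≤ 1 / 128) (hρ : 0 < ρ)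
    (hρa : ρ ≤ a ^ 40) :
    ∃ K : ℕ, 0 < K ∧ ∀ᶠ n : ℕ in atTop, ∃ D D' t m : ℕ, Params a ρ n K D D' t m := by
  have ha1 : a ≤ 1 := by linarith
  have ha12 : 0 < a ^ 12 := by positivity
  have h10 : a ^ 12 < a ^ 10 := pow_lt_pow_right_of_lt_one₀ ha (by linarith) (by norm_num)
  have h40 : a ^ 40 < a ^ 12 := pow_lt_pow_right_of_lt_one₀ ha (by linarith) (by norm_num)
  set K := ⌈(a ^ 12)⁻¹⌉₊ with hK
  have hKle : (a ^ 12)⁻¹ ≤ K := Nat.le_ceil _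
  have hKlt : (K : ℝ) < (a ^ 12)⁻¹ + 1 := Nat.ceil_lt_add_one (by positivity)
  have hinv : 1 ≤ (a ^ 12)⁻¹ := (one_le_inv₀ ha12).2 (pow_le_one₀ ha.le ha1)
  have hK0 : 0 < K := Nat.cast_pos.1 (by linarith : (0 : ℝ) < K)
  have hKa : (K : ℝ) * a ^ 12 ≤ 2 := by
    have : (K : ℝ) * a ^ 12 ≤ ((a ^ 12)⁻¹ + (a ^ 12)⁻¹) * a ^ 12 :=
      mul_le_mul_of_nonneg_right (by linarith) ha12.le
    rw [← two_mul, mul_assoc, inv_mul_cancel₀ ha12.ne', mul_one] at this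
    exact this
  have hK1 : (1 : ℝ) ≤ K := hinv.trans hKle
  have hKs : ((K : ℝ) + 1) * (3 * K + 8) * ρ ≤ 1 / 4 := by
    have e1 : ((K : ℝ) + 1) * (3 * K + 8) ≤ 22 * (K * K) := by nlinarith
    have e2 : ((K : ℝ) * a ^ 12) * (K * a ^ 12) ≤ 2 * 2 :=
      mul_le_mul hKa hKa (by positivity) (by norm_num)
    have e3 : ρ ≤ a ^ 12 * a ^ 12 * a ^ 16 := hρa.trans (by ring_nf; exact le_rfl)
    have e4 : a ^ 16 ≤ (1 / 128) ^ 16 := pow_le_pow_left₀ ha.le ha' 16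
    calc ((K : ℝ) + 1) * (3 * K + 8) * ρ ≤ 22 * (K * K) * (a ^ 12 * a ^ 12 * a ^ 16) :=
          mul_le_mul e1 e3 hρ.le (by positivity)
      _ = 22 * ((K * a ^ 12) * (K * a ^ 12)) * a ^ 16 := by ring
      _ ≤ 22 * (2 * 2) * (1 / 128) ^ 16 :=
          mul_le_mul (by linarith) e4 (by positivity) (by norm_num)
      _ ≤ 1 / 4 := by norm_num
  set x : ℝ := (a ^ 4 / 2) ^ 2 / 2 with hx
  have hx8 : x = a ^ 8 / 8 := by rw [hx]; ring
  have hx1 : x ≤ 1 := by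
    rw [hx8]
    have := pow_le_one₀ (n := 8) ha.le ha1
    linarith
  have hρx : ρ < x := by
    have e1 : a ^ 40 = a ^ 8 * a ^ 32 := by ring
    have e2 : a ^ 32 ≤ (1 / 128) ^ 32 := pow_le_pow_left₀ ha.le ha' 32
    have e3 : 0 < a ^ 8 := by positivity
    rw [hx8]
    nlinarith
  have hc : 0 < x * ρ ^ 2 - ρ ^ 3 := by
    have : x * ρ ^ 2 - ρ ^ 3 = ρ ^ 2 * (x - ρ) := by ring
    rw [this]
    exact mul_pos (pow_pos hρ 2) (by linarith)
  have hcherry : 3 * a ^ 12 < a ^ 4 / 2 := by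
    have e1 : a ^ 12 = a ^ 4 * a ^ 8 := by ring
    have e2 : a ^ 8 ≤ (1 / 128) ^ 8 := pow_le_pow_left₀ ha.le ha' 8
    have e3 : 0 < a ^ 4 := by positivity
    nlinarith
  refine ⟨K, hK0, ?_⟩
  filter_upwards [eventually_gt_atTop 0,
    eventually_linear_le (d := 3 * K + 13) h10,
    eventually_linear_le (d := 1) hcherry,
    eventually_linear_le (d := ((K : ℝ) + 1) * (2 * K + 1))
      (by linarith : ρ / 4 < ρ),
    eventually_linear_le (d := 8) (lt_of_le_of_lt hρa h40),
    -- The constant `exp(-(x + K))` pays for rounding `t` down and for the summand `K` in `m`.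
    eventually_sq_mul_exp_lt hc (Real.exp_pos (-(x + K)))] with n n0 n1 n2 n3 n4 n5
  have hn0 : (0 : ℝ) < n := Nat.cast_pos.2 n0
  have hDle : (⌊a ^ 12 * n⌋₊ : ℝ) ≤ a ^ 12 * n := Nat.floor_le (by positivity)
  have hDlt := Nat.lt_floor_add_one (a ^ 12 * (n : ℝ))
  have hD'le : (⌊a ^ 10 * n⌋₊ : ℝ) ≤ a ^ 10 * n := Nat.floor_le (by positivity)
  have hD'lt := Nat.lt_floor_add_one (a ^ 10 * (n : ℝ))
  have htle : (⌊ρ ^ 2 * n⌋₊ : ℝ) ≤ ρ ^ 2 * n := Nat.floor_le (by positivity)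
  have htlt := Nat.lt_floor_add_one (ρ ^ 2 * (n : ℝ))
  have hmle : (⌊ρ ^ 3 * n⌋₊ : ℝ) ≤ ρ ^ 3 * n := Nat.floor_le (by positivity)
  have hmlt := Nat.lt_floor_add_one (ρ ^ 3 * (n : ℝ))
  set D := ⌊a ^ 12 * n⌋₊
  set D' := ⌊a ^ 10 * n⌋₊
  set t := ⌊ρ ^ 2 * n⌋₊
  set m₀ := ⌊ρ ^ 3 * n⌋₊
  have hsize : (((K + 1) * (2 * K + 1 + t * (3 * K + 8)) : ℕ) : ℝ) ≤ ρ * n := by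
    push_cast
    have e1 : ((K : ℝ) + 1) * (3 * K + 8) * t ≤ ((K : ℝ) + 1) * (3 * K + 8) * (ρ ^ 2 * n) :=
      mul_le_mul_of_nonneg_left htle (by positivity)
    have e2 : ((K : ℝ) + 1) * (3 * K + 8) * ρ * (ρ * n) ≤ 1 / 4 * (ρ * n) :=
      mul_le_mul_of_nonneg_right hKs (by positivity)
    linarith
  refine ⟨D, D', t, m₀ + K, n0, ?_, hDle, hD'le, ?_, ?_, hsize, ?_, ?_, ?_⟩
  · have e1 : (a ^ 12)⁻¹ * (a ^ 12 * n) < K * (D + 1) :=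
      mul_lt_mul' hKle hDlt (by positivity) (by positivity)
    rw [← mul_assoc, inv_mul_cancel₀ ha12.ne', one_mul] at e1
    exact_mod_cast e1
  · have : (D : ℝ) + 3 * K + 12 ≤ D' := by linarith
    exact_mod_cast this
  · linarith
  · have : (((K + 1) * (2 * K + 1 + t * (3 * K + 8)) + 7 : ℕ) : ℝ) ≤ D := by
      rw [Nat.cast_add]
      have : ((7 : ℕ) : ℝ) = 7 := by norm_num
      linarith
    exact_mod_cast this
  · have e1 : (1 - x) ^ t ≤ Real.exp (-(x * t)) := by
      have := pow_le_pow_left₀ (by linarith : 0 ≤ 1 - x) (Real.one_sub_le_exp_neg x) t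
      rw [← Real.exp_nat_mul] at this
      refine this.trans (le_of_eq ?_)
      congr 1
      ring
    have e2 : Real.exp (-((m₀ + K : ℕ) : ℝ)) ≤ (1 / 2) ^ (m₀ + K) := by
      have h2 : Real.exp (-1) ≤ 1 / 2 := by
        rw [Real.exp_neg, one_div]
        refine inv_anti₀ (by norm_num) ?_
        have := Real.add_one_le_exp (1 : ℝ)
        linarith
      have := pow_le_pow_left₀ (Real.exp_pos _).le h2 (m₀ + K)
      rw [← Real.exp_nat_mul] at this
      refine le_trans (le_of_eq ?_) this
      congr 1
      ring
    have hx0 : 0 ≤ x := by rw [hx8]; positivity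
    have e3 : Real.exp (-(x * t)) ≤
        Real.exp (-((x * ρ ^ 2 - ρ ^ 3) * n)) * Real.exp (x - ρ ^ 3 * n) := by
      rw [← Real.exp_add]
      refine Real.exp_le_exp.2 ?_
      have := mul_le_mul_of_nonneg_left htlt.le hx0
      linarith
    have e4 : Real.exp (-(x + K)) * Real.exp (x - ρ ^ 3 * n) ≤
        Real.exp (-((m₀ + K : ℕ) : ℝ)) := by
      rw [← Real.exp_add]
      refine Real.exp_le_exp.2 ?_
      push_cast
      linarith
    calc (n : ℝ) ^ 2 * (1 - x) ^ t
        ≤ (n : ℝ) ^ 2 * (Real.exp (-((x * ρ ^ 2 - ρ ^ 3) * n)) * Real.exp (x - ρ ^ 3 * n)) :=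
          mul_le_mul_of_nonneg_left (e1.trans e3) (by positivity)
      _ = (n : ℝ) ^ 2 * Real.exp (-((x * ρ ^ 2 - ρ ^ 3) * n)) * Real.exp (x - ρ ^ 3 * n) := by
          ring
      _ < Real.exp (-(x + K)) * Real.exp (x - ρ ^ 3 * n) :=
          mul_lt_mul_of_pos_right n5 (Real.exp_pos _)
      _ ≤ _ := e4.trans e2
  · push_cast
    linarith

theorem rpow_le_half_pow {α : ℝ} (hα : 0 < α) (hα' : α ≤ 1 / 64) :
    α ^ (32 / α ^ 2) ≤ (α / 2) ^ 40 := by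
  have h1 : (80 : ℝ) ≤ 32 / α ^ 2 := by
    rw [le_div_iff₀ (by positivity)]
    nlinarith
  have h2 : α ^ (32 / α ^ 2) ≤ α ^ (80 : ℝ) :=
    Real.rpow_le_rpow_of_exponent_ge hα (by linarith) h1
  have h3 : α ^ (80 : ℝ) = (α ^ 2) ^ 40 := by
    rw [← pow_mul]
    exact_mod_cast Real.rpow_natCast α 80
  rw [h3] at h2
  exact h2.trans (pow_le_pow_left₀ (by positivity) (by nlinarith) 40)

end Numerics

end RobustAbsorb

/-! ### The Absorbing Lemma -/

open Classical in
theorem mainTheorem3 :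
    ∃ (α₀ : ℝ → ℝ) (n₀ : ℝ → ℕ), (∀ η : ℝ, 0 < η → 0 < α₀ η) ∧
      ∀ η α ρ : ℝ, 0 < η → 0 < α → α ≤ α₀ η → ρ = α ^ (32 / α ^ 2) →
      ∀ (V : Type*) [Fintype V] (G : SimpleGraph V), n₀ α ≤ Fintype.card V →
        RobustAbsorb.IsRobust G η α →
        (¬ RobustAbsorb.IsNearBipartite G (α ^ 4) →
          ∃ (u v : V) (p : G.Walk u v), p.IsPath ∧
            (p.support.length : ℝ) ≤ ρ * Fintype.card V ∧
            ∀ W : Finset V, (∀ w ∈ W, w ∉ p.support) →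
              (W.card : ℝ) ≤ ρ ^ 3 * Fintype.card V →
              RobustAbsorb.Absorbs G p W) ∧
        (RobustAbsorb.IsNearBipartite G (α ^ 4) →
          ∃ (X Y : Finset V) (H : SimpleGraph V), Y = Xᶜ ∧ H = G.between X Y ∧
            RobustAbsorb.IsRobust H (η / 2) (α / 2) ∧
            ∃ (u v : V) (p : H.Walk u v), p.IsPath ∧
              (p.support.length : ℝ) ≤ ρ * Fintype.card V ∧
              ∀ W : Finset V, (∀ w ∈ W, w ∉ p.support) →
                (W ∩ X).card = (W ∩ Y).card →
                ((W ∩ X).card : ℝ) ≤ ρ ^ 3 * Fintype.card V →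
                RobustAbsorb.Absorbs H p W) := by
  have hthr : ∀ α : ℝ, ∃ N : ℕ, 0 < α → α ≤ 1 / 64 → ∃ K : ℕ, 0 < K ∧ ∀ n, N ≤ n →
      ∃ D D' t m : ℕ, RobustAbsorb.Params (α / 2) (α ^ (32 / α ^ 2)) n K D D' t m := by
    intro α
    by_cases hα : 0 < α ∧ α ≤ 1 / 64
    · obtain ⟨K, hK, hev⟩ := RobustAbsorb.eventually_params (a := α / 2)
        (ρ := α ^ (32 / α ^ 2)) (half_pos hα.1) (by linarith [hα.2]) (Real.rpow_pos_of_pos hα.1 _)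
        (RobustAbsorb.rpow_le_half_pow hα.1 hα.2)
      obtain ⟨N, hN⟩ := Filter.eventually_atTop.1 hev
      exact ⟨N, fun _ _ => ⟨K, hK, hN⟩⟩
    · exact ⟨0, fun h1 h2 => absurd ⟨h1, h2⟩ hα⟩
  choose N hN using hthr
  -- `η / 4` is what the maximum cut needs; `1 / 64` makes the common expansion constant `α / 2` of
  -- `G` and `H` at most `1 / 128`.
  refine ⟨fun η => min (η / 4) (1 / 64), N, fun η hη => by positivity, ?_⟩
  intro η α ρ hη hα hαη hρ V _ G hn hG
  have hα64 : α ≤ 1 / 64 := hαη.trans (min_le_right _ _)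
  have hαη4 : α ≤ η / 4 := hαη.trans (min_le_left _ _)
  obtain ⟨K, hK, hpar⟩ := hN α hα hα64
  obtain ⟨D, D', t, m, hp⟩ := hpar _ hn
  rw [← hρ] at hp
  have ha : 0 < α / 2 := half_pos hα
  have ha' : α / 2 ≤ 1 / 128 := by linarith
  have hne : Nonempty V := Fintype.card_pos_iff.1 hp.pos
  refine ⟨fun hnb => ?_, fun hnb => ?_⟩
  · refine RobustAbsorb.exists_absorbing_path rfl hp ha ha'
      (hG.expands (by linarith) (by linarith)) fun X => ?_
    rw [RobustAbsorb.pairs_self, RobustAbsorb.pairs_self]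
    by_contra hX
    push Not at hX
    have h0 : 0 ≤ α ^ 4 * (Fintype.card V : ℝ) ^ 2 := by positivity
    exact hnb ⟨X, by nlinarith [hX.1], by nlinarith [hX.2]⟩
  · obtain ⟨X, hX⟩ := RobustAbsorb.exists_robust_cut hα (by linarith) (by linarith) hG hnb
    refine ⟨X, Xᶜ, _, rfl, rfl, hX, ?_⟩
    refine RobustAbsorb.exists_absorbing_path_of_bipartite rfl hp ha ha' hK
      (hX.expands (by linarith) le_rfl) fun v w h => ?_
    rw [SimpleGraph.between_adj] at h
    simp only [Finset.mem_coe, Finset.mem_compl] at h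
    tauto
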